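/- Conventions. An MDP over finite sets $S$ (states) and $A$ (actions) is $\mathcal M=(S,A,s_0,P)$ with $s_0\in S$ and $P:S\times A\times S\to[0,1]$ such that $\sum_{s'}P(s,a,s')=1$ for all $(s,a)$. A policy $\pi$ maps finite runs $s_0a_0s_1\dots s_n$ to probability distributions on $A$; together with $\mathcal M$ it induces a probability measure $\mathcal D^{\mathcal M}_\pi$ on infinite runs $\rho=s_0a_0s_1a_1\dots$. Let $AP$ be a finite set and $\lambda:S\times A\times S\to 2^{AP}$ a label function; write $\lambda(\rho)=\lambda(s_0,a_0,s_1)\lambda(s_1,a_1,s_2)\cdots$. A deterministic Rabin automaton (DRA) is $\mathcal A=(Q,2^{AP},q_0,\delta,F)$ with $Q$ finite, $q_0\in Q$, $\delta:Q\times 2^{AP}\to Q$ and $F=\{(A_1,R_1),\dots,(A_n,R_n)\}$, $A_i,R_i\subseteq Q$; it accepts an infinite word if for some $i$ the set of states visited infinitely often meets $A_i$ and is disjoint from $R_i$. A reward machine over $(S,A)$ is $\mathcal R=(U,u_0,\delta_u,\delta_r)$ with $U$ finite, $u_0\in U$, $\delta_u:U\times(S\times A\times S)\to U$ and $\delta_r:U\times(S\times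 A\times S)\to\mathbb R$; along a run, $u_{i+1}=\delta_u(u_i,e_i)$ with $e_i=(s_i,a_i,s_{i+1})$. Put $$J^{\mathcal M}_{\mathcal R^{\mathrm{avg}}}(\pi)=\liminf_{t\to\infty}\mathbb E_{\rho\sim\mathcal D^{\mathcal M}_\pi}\Big[\tfrac1t\sum_{i=0}^{t-1}\delta_r(u_i,e_i)\Big],\qquad J^{\mathcal M}_{\mathcal A}(\pi)=\mathbb P_{\rho\sim\mathcal D^{\mathcal M}_\pi}\big[\lambda(\rho)\text{ is accepted by }\mathcal A\big].$$ Theorem. There is an optimality-preserving specification translation from $\omega$-regular objectives to limit-average rewards given by reward machines. That is: (1) There is a computable function that maps every tuple $(S,A,\lambda,\mathcal A)$ (with the finite sets $S$, $A$, $AP$, $Q$ given as initial segments of $\mathbb N$ and the data coded by finite tables) to a reward machine $\mathcal R=\mathcal R_{(S,A,\lambda,\mathcal A)}$ over $(S,A)$ with rational rewards, such that for every initial state $s_0\in S$ and every transition probability function $P$, with $\mathcal M=(S,A,s_0,P)$, every policy that maximises $J^{\mathcal M}_{\mathcal R^{\mathrm{avg}}}$ over all policies also maximises $J^{\mathcal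 M}_{\mathcal A}$ over all policies. (2) In particular, for arbitrary finite sets $S$, $A$, $AP$, $Q$, every label function $\lambda$ and every DRA $\mathcal A$ with state set $Q$, there is a reward machine $\mathcal R$ over $(S,A)$ such that for all $s_0$ and $P$, with $\mathcal M=(S,A,s_0,P)$, every policy maximising $J^{\mathcal M}_{\mathcal R^{\mathrm{avg}}}$ also maximises $J^{\mathcal M}_{\mathcal A}$. In both parts $\mathcal R$ depends neither on $P$ nor on the support of $P$. -/

import Mathlib

open MeasureTheory ProbabilityTheory Filter

namespace OmegaReg

/-! ## Markov decision processes, policies and the measure on runs -/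

/-- A Markov decision process with state set `S` and action set `A` (finite wherever it is used):
an initial state and, for every state and action, a distribution over successor states. -/
structure MDP (S A : Type*) where
  init : S
  trans : S → A → PMF S

/-- A policy maps finite runs `s₀ a₀ s₁ a₁ … sₙ` to distributions over actions. The finite run is
given by the list `[(s₀, a₀), …, (sₙ₋₁, aₙ₋₁)]` and its last state `sₙ`. -/
abbrev Policy (S A : Type*) := List (S × A) → S → PMF A

/-- Infinite runs `s₀ a₀ s₁ a₁ …`, the `i`-th entry being `(sᵢ, aᵢ)`. -/
abbrev Run (S A : Type*) := ℕ → S × A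

/-- The transition relation of the process of state-action pairs: in state `s` and with action `a`,
the successor state `s'` is drawn from the MDP, and then an action from the policy, whose argument
is the history `h` (which ends with `(s, a)`) followed by `s'`. -/
noncomputable def stepPMF {S A : Type*} (M : MDP S A) (π : Policy S A) (h : List (S × A))
    (s : S) (a : A) : PMF (S × A) :=
  (M.trans s a).bind fun s' => (π h s').map fun a' => (s', a')

section Measure

variable {S A : Type*} [Fintype S] [MeasurableSpace S] [DiscreteMeasurableSpace S]
  [Fintype A] [MeasurableSpace A] [DiscreteMeasurableSpace A]

/-- The same as a Markov kernel from the first `n + 1` state-action pairs to the next one. -/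
noncomputable def stepKernel (M : MDP S A) (π : Policy S A) (n : ℕ) :
    Kernel ((i : Finset.Iic n) → (fun _ : ℕ => S × A) i) ((fun _ : ℕ => S × A) (n + 1)) :=
  Kernel.ofFunOfCountable fun x =>
    (stepPMF M π
      (List.ofFn fun i : Fin (n + 1) => x ⟨i, Finset.mem_Iic.2 (Nat.lt_succ_iff.1 i.2)⟩)
      (x ⟨n, Finset.mem_Iic.2 le_rfl⟩).1 (x ⟨n, Finset.mem_Iic.2 le_rfl⟩).2).toMeasure

instance (M : MDP S A) (π : Policy S A) (n : ℕ) : IsMarkovKernel (stepKernel M π n) :=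
  ⟨fun _ => by
    change IsProbabilityMeasure (PMF.toMeasure _)
    infer_instance⟩

/-- The law of the first state-action pair. -/
noncomputable def initMeasure (M : MDP S A) (π : Policy S A) : Measure (S × A) :=
  ((π [] M.init).map fun a => (M.init, a)).toMeasure

instance (M : MDP S A) (π : Policy S A) : IsProbabilityMeasure (initMeasure M π) := by
  unfold initMeasure
  infer_instance

/-- The probability measure on infinite runs induced by an MDP and a policy. -/
noncomputable def runMeasure (M : MDP S A) (π : Policy S A) : Measure (Run S A) :=
  Kernel.trajMeasure (X := fun _ : ℕ => S × A) (initMeasure M π) (stepKernel M π)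

end Measure

/-! ## Rabin automata and acceptance -/

/-- A deterministic Rabin automaton with states `Q` over the alphabet `2^AP`, with acceptance
condition `(A₁, R₁), …, (Aₙ, Rₙ)`. -/
structure DRA (Q AP : Type*) where
  init : Q
  step : Q → Finset AP → Q
  acc : List (Finset Q × Finset Q)

namespace DRA

variable {Q AP : Type*}

/-- The state reached after reading the first `i` letters of `w`. -/
def stateAt (D : DRA Q AP) (w : ℕ → Finset AP) : ℕ → Q
  | 0 => D.init
  | i + 1 => D.step (D.stateAt w i) (w i)

/-- The states that are visited infinitely often on `w`. -/
def infStates (D : DRA Q AP) (w : ℕ → Finset AP) : Set Q :=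
  {q | ∃ᶠ i in atTop, D.stateAt w i = q}

/-- Rabin acceptance: for some pair, the first set is visited infinitely often and every state of
the second set only finitely often. -/
def Accepts (D : DRA Q AP) (w : ℕ → Finset AP) : Prop :=
  ∃ p ∈ D.acc, (D.infStates w ∩ ↑p.1).Nonempty ∧ D.infStates w ∩ ↑p.2 = ∅

end DRA

/-- The sequence of labels along a run. -/
def labels {S A AP : Type*} (lab : S → A → S → Finset AP) (ρ : Run S A) : ℕ → Finset AP :=
  fun i => lab (ρ i).1 (ρ i).2 (ρ (i + 1)).1

/-! ## Reward machines -/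

/-- A reward machine with state set `U` (finite wherever it is used). -/
structure RewardMachine (U S A : Type*) where
  init : U
  update : U → S → A → S → U
  reward : U → S → A → S → ℝ

/-- The state of the reward machine after the first `i` transitions of a run. -/
def RewardMachine.stateAt {U S A : Type*} (R : RewardMachine U S A) (ρ : Run S A) : ℕ → U
  | 0 => R.init
  | i + 1 => R.update (R.stateAt ρ i) (ρ i).1 (ρ i).2 (ρ (i + 1)).1

/-- The reward emitted for the `i`-th transition of a run. -/
def RewardMachine.rewardAt {U S A : Type*} (R : RewardMachine U S A) (ρ : Run S A) (i : ℕ) : ℝ :=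
  R.reward (R.stateAt ρ i) (ρ i).1 (ρ i).2 (ρ (i + 1)).1

/-! ## The two objectives and preservation of optimality -/

section Objectives

variable {S A : Type*} [Fintype S] [MeasurableSpace S] [DiscreteMeasurableSpace S]
  [Fintype A] [MeasurableSpace A] [DiscreteMeasurableSpace A]

/-- The limit-average reward of a policy. -/
noncomputable def limitAverage {U : Type*} (M : MDP S A) (R : RewardMachine U S A)
    (π : Policy S A) : ℝ :=
  liminf (fun t : ℕ => ∫ ρ, (1 / (t : ℝ)) * ∑ i ∈ Finset.range t, R.rewardAt ρ i
    ∂(runMeasure M π)) atTop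

/-- The probability that the labels of a run are accepted by the automaton. -/
noncomputable def acceptProb {Q AP : Type*} (M : MDP S A) (lab : S → A → S → Finset AP)
    (D : DRA Q AP) (π : Policy S A) : ℝ :=
  (runMeasure M π).real {ρ | D.Accepts (labels lab ρ)}

/-- `R` preserves optimality for the objective given by `lab` and `D`: for every MDP over `S` and
`A` (every initial state and all transition probabilities), each policy that maximises the
limit-average reward also maximises the probability of acceptance. -/
def OptimalityPreserving {Q AP U : Type*} (lab : S → A → S → Finset AP) (D : DRA Q AP)
    (R : RewardMachine U S A) : Prop :=
  ∀ (M : MDP S A) (π : Policy S A),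
    (∀ π', limitAverage M R π' ≤ limitAverage M R π) →
      ∀ π', acceptProb M lab D π' ≤ acceptProb M lab D π

end Objectives

/-! ## Finite presentations and computability of a translation -/

/-- A tuple `(S, A, label function, DRA)` whose finite sets are initial segments of `ℕ`. -/
structure Spec where
  nS : ℕ
  nA : ℕ
  nAP : ℕ
  nQ : ℕ
  label : Fin nS → Fin nA → Fin nS → Finset (Fin nAP)
  dra : DRA (Fin nQ) (Fin nAP)

/-- A reward machine over `Fin nS` and `Fin nA` with finitely many states and rational rewards, so
that it is a finite object. -/
structure FiniteRewardMachine (nS nA : ℕ) where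
  nU : ℕ
  init : Fin nU
  update : Fin nU → Fin nS → Fin nA → Fin nS → Fin nU
  reward : Fin nU → Fin nS → Fin nA → Fin nS → ℚ

/-- The underlying reward machine. -/
def FiniteRewardMachine.toRewardMachine {nS nA : ℕ} (R : FiniteRewardMachine nS nA) :
    RewardMachine (Fin R.nU) (Fin nS) (Fin nA) where
  init := R.init
  update := R.update
  reward u s a s' := (R.reward u s a s' : ℝ)

/-- The binary code of a finite set of natural numbers below `n`. -/
def setCode {n : ℕ} (s : Finset (Fin n)) : ℕ := ∑ i ∈ s, 2 ^ (i : ℕ)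

/-- The finite set with binary code `j`. -/
def setOfCode (n j : ℕ) : Finset (Fin n) := Finset.univ.filter fun i => j.testBit i

/-- Four sizes; the table of the label function; initial state, transition table (columns indexed by
the codes of the letters) and acceptance pairs of the automaton. -/
abbrev SpecCode :=
  (ℕ × ℕ × ℕ × ℕ) × List (List (List ℕ)) × ℕ × List (List ℕ) × List (ℕ × ℕ)

/-- The code of a specification. -/
def Spec.code (X : Spec) : SpecCode :=
  ((X.nS, X.nA, X.nAP, X.nQ),
    List.ofFn fun s => List.ofFn fun a => List.ofFn fun s' => setCode (X.label s a s'),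
    X.dra.init,
    List.ofFn fun q => List.ofFn fun j : Fin (2 ^ X.nAP) =>
      (X.dra.step q (setOfCode X.nAP j) : ℕ),
    X.dra.acc.map fun p => (setCode p.1, setCode p.2))

/-- Number of states, initial state, and a table of the successor state together with numerator and
denominator of the reward. -/
abbrev MachineCode := ℕ × ℕ × List (List (List (List (ℕ × ℤ × ℕ))))

/-- The code of a finite reward machine. -/
def FiniteRewardMachine.code {nS nA : ℕ} (R : FiniteRewardMachine nS nA) : MachineCode :=
  (R.nU, R.init,
    List.ofFn fun u => List.ofFn fun s => List.ofFn fun a => List.ofFn fun s' =>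
      ((R.update u s a s' : ℕ), (R.reward u s a s').num, (R.reward u s a s').den))

/-- A translation of specifications to reward machines is computable if some computable (recursive)
function maps the code of every specification to the code of its reward machine. -/
def ComputableTranslation (τ : (X : Spec) → FiniteRewardMachine X.nS X.nA) : Prop :=
  ∃ f : SpecCode → MachineCode, Computable f ∧ ∀ X : Spec, f X.code = (τ X).code

end OmegaReg

/-!
The reward machine of the translation runs the automaton and collects the set `E` of all transitions
of the product of MDP and automaton that it has seen. It pays `1` when, in every product state, `E`
uses at most one action, and the states reachable in `E` from the current product state satisfy the
Rabin condition; otherwise it pays `0`. Support and probabilities of the MDP do not enter.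

Why this preserves optimality: almost every run is fair (`ae_isFair`), that is, a transition of
positive probability whose source and action occur infinitely often is itself taken infinitely
often. Along a fair run `E` stabilises. If it then uses one action in each product state, the states
reachable from the current one are exactly those visited infinitely often. So a fair run that is not
accepted eventually earns nothing, and by dominated convergence no policy earns more than its
probability of acceptance (`limitAverage_edgeMachine_le`). Conversely, an accepted fair run of a
positional strategy of the product eventually earns `1` in each step, so that positional strategies
earn their probability of acceptance (`acceptProb_le_limitAverage_edgeMachine`). It remains to know
that some positional strategy maximises the probability of acceptance
(`exists_positional_optimal`); then a policy of maximal limit-average reward is accepted at least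
with that maximal probability.

For the positional optimum, let `Win σ` be the set of product states from which all reachable
recurrent classes of the strategy `σ` are accepting. Two strategies can be merged, so that a single
strategy wins on the union `W` of all these sets (`exists_win_maximal`). A fair accepted run visits
`W`, as the states that it visits infinitely often carry a winning strategy
(`IsFair.exists_mem_win`). Outside `W` it suffices to maximise the probability of reaching `W`. For
the discounted version of this objective the fixed point of the Bellman operator yields a positional
optimum, one strategy serves infinitely many discount factors tending to `1`, and this strategy is
optimal in the limit.

For computability, the sets of transitions are coded in binary, and reachability is expressed by
bounded quantifiers over codes of closed sets, so that the table of the machine is primitive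
recursive in the specification (`SpecCode.primrec_machine`). The coded machine simulates the
abstract one (`Spec.optimalityPreserving_rewardMachine`).
-/

namespace OmegaReg

/-! ### The law of the next step of a run -/

section NextStep

open Preorder

/-- The value of `f` depends only on the entries `0, …, n` of a run. -/
def UpTo {S A β : Type*} (n : ℕ) (f : Run S A → β) : Prop :=
  ∀ ρ ρ' : Run S A, (∀ i ≤ n, ρ i = ρ' i) → f ρ = f ρ'

/-- The first `n + 1` state-action pairs of a run. -/
def hist {S A : Type*} (ρ : Run S A) (n : ℕ) : List (S × A) :=
  List.ofFn fun i : Fin (n + 1) => ρ i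

/-- The distribution of the entry `n + 1` of a run, given the entries up to `n`. -/
noncomputable def nextPMF {S A : Type*} (M : MDP S A) (π : Policy S A) (ρ : Run S A) (n : ℕ) :
    PMF (S × A) :=
  stepPMF M π (hist ρ n) (ρ n).1 (ρ n).2

/-- The run that starts with the given finite sequence and then repeats its last entry. -/
def extendRun {S A : Type*} {n : ℕ} (x : (i : Finset.Iic n) → (fun _ : ℕ => S × A) i) : Run S A :=
  fun i => if h : i ≤ n then x ⟨i, Finset.mem_Iic.2 h⟩ else x ⟨n, Finset.mem_Iic.2 le_rfl⟩

theorem UpTo.mono {S A β : Type*} {n m : ℕ} (h : n ≤ m) {f : Run S A → β} (hf : UpTo n f) :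
    UpTo m f :=
  fun _ _ hρ => hf _ _ fun i hi => hρ i (hi.trans h)

theorem UpTo.comp {S A β γ : Type*} {n : ℕ} {f : Run S A → β} (hf : UpTo n f) (g : β → γ) :
    UpTo n fun ρ => g (f ρ) :=
  fun _ _ hρ => congrArg g (hf _ _ hρ)

theorem UpTo.comp₂ {S A β γ δ : Type*} {n : ℕ} {f : Run S A → β} {f' : Run S A → γ}
    (hf : UpTo n f) (hf' : UpTo n f') (g : β → γ → δ) : UpTo n fun ρ => g (f ρ) (f' ρ) :=
  fun _ _ hρ => congrArg₂ g (hf _ _ hρ) (hf' _ _ hρ)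

theorem upTo_apply {S A : Type*} {i n : ℕ} (h : i ≤ n) : UpTo n fun ρ : Run S A => ρ i :=
  fun _ _ hρ => hρ i h

/-- A measurable set in the `n`-th σ-algebra is determined by the entries up to `n`. -/
theorem upTo_of_measurableSet_piLE {S A : Type*} [MeasurableSpace S] [MeasurableSpace A]
    {n : ℕ} {B : Set (Run S A)}
    (hB : MeasurableSet[Filtration.piLE (X := fun _ : ℕ => S × A) n] B) :
    UpTo n fun ρ => ρ ∈ B := by
  rw [Filtration.piLE_eq_comap_frestrictLe] at hB
  obtain ⟨C, -, rfl⟩ := hB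
  intro ρ ρ' h
  have : frestrictLe (π := fun _ : ℕ => S × A) n ρ = frestrictLe n ρ' := by
    funext i
    exact h i (Finset.mem_Iic.1 i.2)
  simp only [Set.mem_preimage, this]

theorem UpTo.exists_bound {S A : Type*} [Finite S] [Finite A] {n : ℕ} {f : Run S A → ℝ}
    (hf : UpTo n f) : ∃ C, ∀ ρ, ‖f ρ‖ ≤ C := by
  have hfin : (Set.range fun ρ => ‖f ρ‖).Finite := by
    refine (Set.finite_range fun x : (i : Finset.Iic n) → (fun _ : ℕ => S × A) i =>
      ‖f (extendRun x)‖).subset ?_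
    rintro _ ⟨ρ, rfl⟩
    refine ⟨frestrictLe (π := fun _ : ℕ => S × A) n ρ, ?_⟩
    exact congrArg _ (hf _ _ fun i hi => by simp [extendRun, hi])
  obtain ⟨C, hC⟩ := hfin.bddAbove
  exact ⟨C, fun ρ => hC ⟨ρ, rfl⟩⟩

theorem hist_upTo {S A : Type*} (n : ℕ) : UpTo n fun ρ : Run S A => hist ρ n := by
  intro ρ ρ' h
  simp only [hist]
  congr 1
  funext i
  exact h i (Nat.lt_succ_iff.1 i.2)

theorem nextPMF_upTo {S A : Type*} (M : MDP S A) (π : Policy S A) (n : ℕ) :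
    UpTo n fun ρ => nextPMF M π ρ n :=
  (hist_upTo n).comp₂ (upTo_apply le_rfl) fun h z => stepPMF M π h z.1 z.2

theorem nextPMF_ne_zero_iff {S A : Type*} (M : MDP S A) (π : Policy S A) (ρ : Run S A) (n : ℕ)
    (z : S × A) : nextPMF M π ρ n z ≠ 0 ↔
      M.trans (ρ n).1 (ρ n).2 z.1 ≠ 0 ∧ π (hist ρ n) z.1 z.2 ≠ 0 := by
  rw [← PMF.mem_support_iff, nextPMF, stepPMF, PMF.mem_support_bind_iff]
  simp only [PMF.mem_support_map_iff]
  constructor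
  · rintro ⟨s, hs, a, ha, rfl⟩
    exact ⟨(PMF.mem_support_iff _ _).1 hs, (PMF.mem_support_iff _ _).1 ha⟩
  · rintro ⟨hs, ha⟩
    exact ⟨z.1, (PMF.mem_support_iff _ _).2 hs, z.2, (PMF.mem_support_iff _ _).2 ha, rfl⟩

variable {S A : Type*} [Fintype S] [MeasurableSpace S] [DiscreteMeasurableSpace S]
  [Fintype A] [MeasurableSpace A] [DiscreteMeasurableSpace A]

instance (M : MDP S A) (π : Policy S A) : IsProbabilityMeasure (runMeasure M π) := by
  unfold runMeasure
  infer_instance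

/-- Since `S` and `A` are finite, every function of finitely many entries is measurable. -/
theorem UpTo.measurable_piLE {β : Type*} [MeasurableSpace β] {n : ℕ} {f : Run S A → β}
    (hf : UpTo n f) : Measurable[Filtration.piLE (X := fun _ : ℕ => S × A) n] f := by
  have hfac : f = (fun x => f (extendRun x)) ∘ frestrictLe (π := fun _ : ℕ => S × A) n := by
    funext ρ
    refine hf _ _ fun i hi => ?_
    simp [extendRun, hi]
  rw [hfac, Filtration.piLE_eq_comap_frestrictLe]
  exact Measurable.comp (measurable_from_top.mono (by
    intro s _; exact (Set.toFinite s).measurableSet) le_rfl) (comap_measurable _)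

theorem UpTo.measurable {β : Type*} [MeasurableSpace β] {n : ℕ} {f : Run S A → β}
    (hf : UpTo n f) : Measurable f :=
  hf.measurable_piLE.mono (Filtration.piLE.le n) le_rfl

theorem UpTo.measurableSet_piLE {n : ℕ} {p : Run S A → Prop}
    (hf : UpTo n p) : MeasurableSet[Filtration.piLE (X := fun _ : ℕ => S × A) n] {ρ | p ρ} :=
  hf.measurable_piLE (measurableSet_setOfPred.2 measurable_id : MeasurableSet {q : Prop | q})

theorem UpTo.measurableSet {n : ℕ} {p : Run S A → Prop} (hf : UpTo n p) :
    MeasurableSet {ρ | p ρ} :=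
  Filtration.piLE.le n _ hf.measurableSet_piLE

theorem UpTo.integrable {n : ℕ} {f : Run S A → ℝ} (hf : UpTo n f) (μ : Measure (Run S A))
    [IsFiniteMeasure μ] : Integrable f μ := by
  obtain ⟨C, hC⟩ := hf.exists_bound
  exact Integrable.of_bound hf.measurable.aestronglyMeasurable C (ae_of_all _ hC)

/-- The expectation of a function of the entries up to `n + 1` is computed by averaging over the
last entry with the transition probabilities. -/
theorem integral_upTo_succ (M : MDP S A) (π : Policy S A) {n : ℕ} {f : Run S A → ℝ}
    (hf : UpTo (n + 1) f) :
    ∫ ρ, f ρ ∂(runMeasure M π) =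
      ∫ ρ, ∑ z, (nextPMF M π ρ n z).toReal * f (Function.update ρ (n + 1) z)
        ∂(runMeasure M π) := by
  classical
  have key := Kernel.map_frestrictLe_trajMeasure_compProd_eq_map_trajMeasure
    (X := fun _ : ℕ => S × A) (μ₀ := initMeasure M π) (κ := stepKernel M π) (a := n)
  set g : ((i : Finset.Iic n) → (fun _ : ℕ => S × A) i) × (S × A) → ℝ :=
    fun p => f (Function.update (extendRun p.1) (n + 1) p.2) with hg
  have hgm : Measurable g := fun s _ => (Set.toFinite _).measurableSet
  have hfg : ∀ ρ : Run S A, f ρ = g (frestrictLe (π := fun _ : ℕ => S × A) n ρ, ρ (n + 1)) := by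
    intro ρ
    refine hf _ _ fun i hi => ?_
    rcases Nat.lt_or_ge n i with h | h
    · obtain rfl : i = n + 1 := by omega
      simp
    · rw [Function.update_of_ne (by omega)]
      simp [extendRun, h]
  have hmm : Measurable fun ρ : Run S A =>
      (frestrictLe (π := fun _ : ℕ => S × A) n ρ, ρ (n + 1)) := by fun_prop
  have e1 : ∫ ρ, f ρ ∂(runMeasure M π) = ∫ p, g p ∂((runMeasure M π).map fun ρ : Run S A =>
      (frestrictLe (π := fun _ : ℕ => S × A) n ρ, ρ (n + 1))) := by
    rw [integral_map hmm.aemeasurable hgm.aestronglyMeasurable]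
    exact integral_congr_ae (ae_of_all _ hfg)
  have hP : IsProbabilityMeasure ((runMeasure M π).map
      (frestrictLe (π := fun _ : ℕ => S × A) n)) :=
    Measure.isProbabilityMeasure_map (by fun_prop)
  rw [e1]
  unfold runMeasure at hP ⊢
  rw [← key, Measure.integral_compProd Integrable.of_finite,
    integral_map (by fun_prop) (StronglyMeasurable.aestronglyMeasurable
      (Measurable.stronglyMeasurable fun s _ => (Set.toFinite _).measurableSet))]
  refine integral_congr_ae (ae_of_all _ fun ρ => ?_)
  simp only
  have : stepKernel M π n (frestrictLe (π := fun _ : ℕ => S × A) n ρ) =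
      (nextPMF M π ρ n).toMeasure := rfl
  rw [this, PMF.integral_eq_sum]
  refine Finset.sum_congr rfl fun z _ => ?_
  rw [smul_eq_mul, hg]
  congr 1
  refine hf _ _ fun i hi => ?_
  rcases Nat.lt_or_ge n i with h | h
  · obtain rfl : i = n + 1 := by omega
    simp
  · rw [Function.update_of_ne (by omega), Function.update_of_ne (by omega)]
    simp [extendRun, h]

/-- A property of the entries up to `n + 1` that holds for every possible value of the last entry
holds almost surely. -/
theorem ae_of_forall_next (M : MDP S A) (π : Policy S A) {n : ℕ} {p : Run S A → Prop}
    (hp : UpTo (n + 1) p)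
    (h : ∀ ρ z, nextPMF M π ρ n z ≠ 0 → p (Function.update ρ (n + 1) z)) :
    ∀ᵐ ρ ∂(runMeasure M π), p ρ := by
  classical
  have hm : MeasurableSet {ρ : Run S A | ¬ p ρ} := (hp.comp Not).measurableSet
  have hf : UpTo (n + 1) ({ρ : Run S A | ¬ p ρ}.indicator (1 : Run S A → ℝ)) := by
    intro ρ ρ' hρ
    simp only [Set.indicator_apply, Set.mem_ofPred_eq, hp ρ ρ' hρ, Pi.one_apply]
  have := integral_upTo_succ M π hf
  rw [integral_indicator_one hm] at this
  have h0 : ∀ ρ : Run S A, ∑ z, (nextPMF M π ρ n z).toReal *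
      {ρ : Run S A | ¬ p ρ}.indicator (1 : Run S A → ℝ) (Function.update ρ (n + 1) z) = 0 := by
    intro ρ
    refine Finset.sum_eq_zero fun z _ => ?_
    by_cases hz : nextPMF M π ρ n z = 0
    · simp [hz]
    · simp [h ρ z hz]
  simp only [h0, integral_zero] at this
  rw [measureReal_eq_zero_iff] at this
  exact this

/-- The law of the first entry. -/
theorem ae_init (M : MDP S A) (π : Policy S A) :
    ∀ᵐ ρ ∂(runMeasure M π), (ρ 0).1 = M.init ∧ π [] M.init (ρ 0).2 ≠ 0 := by
  have hmap : (runMeasure M π).map (fun ρ : Run S A => ρ 0) = initMeasure M π := by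
    unfold runMeasure Kernel.trajMeasure
    have h1 : (fun ρ : Run S A => ρ 0) =
        (MeasurableEquiv.piUnique fun i : Finset.Iic 0 => (fun _ : ℕ => S × A) i) ∘
          frestrictLe (π := fun _ : ℕ => S × A) 0 := by
      funext ρ
      rfl
    rw [h1, ← Measure.map_map (by fun_prop) (by fun_prop), Measure.map_comp _ _ (by fun_prop),
      Kernel.traj_map_frestrictLe, Kernel.partialTraj_self, Measure.id_comp,
      Measure.map_map (by fun_prop) (by fun_prop)]
    exact Measure.map_id
  have h2 : ∀ᵐ z ∂(initMeasure M π), z.1 = M.init ∧ π [] M.init z.2 ≠ 0 := by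
    unfold initMeasure
    rw [ae_iff, PMF.toMeasure_apply_eq_zero_iff _ (Set.toFinite _).measurableSet,
      Set.disjoint_left]
    intro z hz hz'
    rw [PMF.mem_support_map_iff] at hz
    obtain ⟨a, ha, rfl⟩ := hz
    exact hz' ⟨rfl, (PMF.mem_support_iff _ _).1 ha⟩
  rw [← hmap] at h2
  exact ae_of_ae_map (measurable_pi_apply 0).aemeasurable h2

/-- Almost surely, every step has positive probability. -/
theorem ae_next (M : MDP S A) (π : Policy S A) :
    ∀ᵐ ρ ∂(runMeasure M π), ∀ n, M.trans (ρ n).1 (ρ n).2 (ρ (n + 1)).1 ≠ 0 ∧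
      π (hist ρ n) (ρ (n + 1)).1 (ρ (n + 1)).2 ≠ 0 := by
  rw [ae_all_iff]
  intro n
  have : UpTo (n + 1) fun ρ : Run S A => nextPMF M π ρ n (ρ (n + 1)) ≠ 0 :=
    ((nextPMF_upTo M π n).mono n.le_succ).comp₂ (upTo_apply le_rfl) fun p z => p z ≠ 0
  filter_upwards [ae_of_forall_next M π this (by
    intro ρ z hz
    have := nextPMF_upTo M π n _ ρ fun i hi =>
      Function.update_of_ne (show i ≠ n + 1 by omega) z ρ
    simp only at this
    rwa [this, Function.update_self])] with ρ hρ
  exact (nextPMF_ne_zero_iff M π ρ n _).1 hρ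

end NextStep

/-! ### The product of an MDP and an automaton -/

section Product

variable {S A AP Q : Type*}

/-- The state of the run and of the automaton after `n` steps. -/
def prodState (lab : S → A → S → Finset AP) (D : DRA Q AP) (ρ : Run S A) (n : ℕ) : S × Q :=
  ((ρ n).1, D.stateAt (labels lab ρ) n)

/-- The successor of a product state when action `a` leads to the state `s'`. -/
def prodNext (lab : S → A → S → Finset AP) (D : DRA Q AP) (x : S × Q) (a : A) (s' : S) : S × Q :=
  (s', D.step x.2 (lab x.1 a s'))

/-- The transition probabilities of the product. -/
noncomputable def prodTrans (M : MDP S A) (lab : S → A → S → Finset AP) (D : DRA Q AP) (x : S × Q)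
    (a : A) : PMF (S × Q) :=
  (M.trans x.1 a).map (prodNext lab D x a)

variable (lab : S → A → S → Finset AP) (D : DRA Q AP)

theorem prodState_succ (ρ : Run S A) (n : ℕ) :
    prodState lab D ρ (n + 1) = prodNext lab D (prodState lab D ρ n) (ρ n).2 (ρ (n + 1)).1 :=
  rfl

/-- The `n`-th product state depends on the first `n` state-action pairs and the `n`-th state. -/
theorem prodState_congr {ρ ρ' : Run S A} {n : ℕ} (h : ∀ i < n, ρ i = ρ' i)
    (hn : (ρ n).1 = (ρ' n).1) : prodState lab D ρ n = prodState lab D ρ' n := by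
  induction n with
  | zero => simp [prodState, DRA.stateAt, hn]
  | succ n ih =>
    rw [prodState_succ, prodState_succ, hn, h n n.lt_succ_self,
      ih (fun i hi => h i (hi.trans n.lt_succ_self)) (by rw [h n n.lt_succ_self])]

theorem prodState_upTo (n : ℕ) : UpTo n fun ρ : Run S A => prodState lab D ρ n :=
  fun _ _ h => prodState_congr lab D (fun i hi => h i hi.le) (by rw [h n le_rfl])

theorem sum_map_toReal {α β : Type*} [Fintype α] [Fintype β] (p : PMF α) (f : α → β)
    (g : β → ℝ) : ∑ y, (p.map f y).toReal * g y = ∑ z, (p z).toReal * g (f z) := by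
  classical
  have h : ∀ y, (p.map f y).toReal = ∑ z, if y = f z then (p z).toReal else 0 := by
    intro y
    rw [PMF.map_apply, tsum_fintype, ENNReal.toReal_sum]
    · refine Finset.sum_congr rfl fun z _ => ?_
      split_ifs <;> rfl
    · intro z _
      split_ifs
      · exact p.apply_ne_top z
      · exact ENNReal.zero_ne_top
  simp only [h, Finset.sum_mul]
  rw [Finset.sum_comm]
  refine Finset.sum_congr rfl fun z _ => ?_
  rw [Finset.sum_eq_single (f z)]
  · simp
  · intro y _ hy
    simp [hy]
  · simp

theorem nextPMF_map_prodNext (M : MDP S A) (π : Policy S A) (ρ : Run S A) (n : ℕ) :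
    (nextPMF M π ρ n).map (fun z => prodNext lab D (prodState lab D ρ n) (ρ n).2 z.1) =
      prodTrans M lab D (prodState lab D ρ n) (ρ n).2 := by
  have h : (nextPMF M π ρ n).map Prod.fst = M.trans (ρ n).1 (ρ n).2 := by
    simp only [nextPMF, stepPMF, PMF.map_bind, PMF.map_comp]
    conv_rhs => rw [← PMF.bind_pure (M.trans (ρ n).1 (ρ n).2)]
    congr 1
    funext s
    exact PMF.map_const _ _
  rw [prodTrans, show (prodState lab D ρ n).1 = (ρ n).1 from rfl, ← h, PMF.map_comp]
  rfl

/-- A run is fair if it takes only steps of positive probability and if each step of positive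
probability is taken infinitely often, provided that its source and action are chosen infinitely
often. -/
structure IsFair (M : MDP S A) (ρ : Run S A) : Prop where
  prodTrans_ne_zero : ∀ n,
    prodTrans M lab D (prodState lab D ρ n) (ρ n).2 (prodState lab D ρ (n + 1)) ≠ 0
  frequently_of_ne_zero : ∀ x a y, (∃ᶠ n in atTop, prodState lab D ρ n = x ∧ (ρ n).2 = a) →
    prodTrans M lab D x a y ≠ 0 →
    ∃ᶠ n in atTop, (prodState lab D ρ n = x ∧ (ρ n).2 = a) ∧ prodState lab D ρ (n + 1) = y

variable [Fintype S] [MeasurableSpace S] [DiscreteMeasurableSpace S]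
  [Fintype A] [MeasurableSpace A] [DiscreteMeasurableSpace A] [Fintype Q]

/-- The Markov property of the product: conditionally on the past, the next product state is
drawn from the transition probabilities of the product. -/
theorem condExp_prodState_succ (M : MDP S A) (π : Policy S A) (n : ℕ) (g : S × Q → ℝ) :
    (runMeasure M π)[fun ρ => g (prodState lab D ρ (n + 1)) |
        Filtration.piLE (X := fun _ : ℕ => S × A) n] =ᵐ[runMeasure M π]
      fun ρ => ∑ y, (prodTrans M lab D (prodState lab D ρ n) (ρ n).2 y).toReal * g y := by
  classical
  have hr : UpTo n fun ρ : Run S A =>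
      ∑ y, (prodTrans M lab D (prodState lab D ρ n) (ρ n).2 y).toReal * g y :=
    (prodState_upTo lab D n).comp₂ (upTo_apply le_rfl) fun x z =>
      ∑ y, (prodTrans M lab D x z.2 y).toReal * g y
  have hl : UpTo (n + 1) fun ρ : Run S A => g (prodState lab D ρ (n + 1)) :=
    (prodState_upTo lab D (n + 1)).comp g
  refine (ae_eq_condExp_of_forall_setIntegral_eq (Filtration.piLE.le n)
    (hl.integrable _) (fun _ _ _ => (hr.integrable _).integrableOn) (fun B hB _ => ?_)
    hr.measurable_piLE.stronglyMeasurable.aestronglyMeasurable).symm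
  have hB' := upTo_of_measurableSet_piLE hB
  have hBm := Filtration.piLE.le n _ hB
  rw [← integral_indicator hBm, ← integral_indicator hBm]
  have hi : UpTo (n + 1) (B.indicator fun ρ : Run S A => g (prodState lab D ρ (n + 1))) := by
    intro ρ ρ' h
    simp only [Set.indicator_apply, hl ρ ρ' h, (hB'.mono n.le_succ) ρ ρ' h]
  rw [integral_upTo_succ M π hi]
  refine integral_congr_ae (ae_of_all _ fun ρ => ?_)
  have hu : ∀ z, ∀ i ≤ n, Function.update ρ (n + 1) z i = ρ i :=
    fun z i h => Function.update_of_ne (by omega) _ _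
  simp only [Set.indicator_apply, fun z => hB' _ ρ (hu z)]
  split_ifs with hρ
  · rw [← nextPMF_map_prodNext lab D M π ρ n, sum_map_toReal]
    refine Finset.sum_congr rfl fun z _ => ?_
    have := prodState_upTo lab D n _ ρ (hu z)
    simp only at this
    rw [prodState_succ, this, hu z n le_rfl, Function.update_self]
  · simp

/-- The form of the Markov property used for (super)martingale estimates. -/
theorem integral_mul_prodState_succ (M : MDP S A) (π : Policy S A) {n : ℕ} {f : Run S A → ℝ}
    (hf : UpTo n f) (g : S × Q → ℝ) :
    ∫ ρ, f ρ * g (prodState lab D ρ (n + 1)) ∂(runMeasure M π) =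
      ∫ ρ, f ρ * ∑ y, (prodTrans M lab D (prodState lab D ρ n) (ρ n).2 y).toReal * g y
        ∂(runMeasure M π) := by
  have hl : UpTo (n + 1) fun ρ : Run S A => g (prodState lab D ρ (n + 1)) :=
    (prodState_upTo lab D (n + 1)).comp g
  have hfg : UpTo (n + 1) (f * fun ρ : Run S A => g (prodState lab D ρ (n + 1))) :=
    (hf.mono n.le_succ).comp₂ hl fun a b => a * b
  have h1 := condExp_mul_of_stronglyMeasurable_left (μ := runMeasure M π)
    hf.measurable_piLE.stronglyMeasurable (hfg.integrable _) (hl.integrable _)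
  have h2 := integral_condExp (μ := runMeasure M π)
    ((Filtration.piLE (X := fun _ : ℕ => S × A)).le n)
    (f := f * fun ρ : Run S A => g (prodState lab D ρ (n + 1)))
  rw [integral_congr_ae h1] at h2
  change ∫ ρ, (f * fun ρ : Run S A => g (prodState lab D ρ (n + 1))) ρ ∂(runMeasure M π) = _
  rw [← h2]
  refine integral_congr_ae ?_
  filter_upwards [condExp_prodState_succ lab D M π n g] with ρ hρ
  rw [Pi.mul_apply, hρ]

/-- Almost every run is fair: this is Lévy's conditional Borel–Cantelli lemma, applied to each of
the finitely many transitions of the product. -/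
theorem ae_isFair (M : MDP S A) (π : Policy S A) :
    ∀ᵐ ρ ∂(runMeasure M π), IsFair lab D M ρ := by
  classical
  have h2 : ∀ (x : S × Q) (a : A) (y : S × Q), ∀ᵐ ρ ∂(runMeasure M π),
      (∃ᶠ n in atTop, prodState lab D ρ n = x ∧ (ρ n).2 = a) → prodTrans M lab D x a y ≠ 0 →
      ∃ᶠ n in atTop, (prodState lab D ρ n = x ∧ (ρ n).2 = a) ∧
        prodState lab D ρ (n + 1) = y := by
    intro x a y
    have hu : ∀ n, UpTo n fun ρ : Run S A => prodState lab D ρ n = x ∧ (ρ n).2 = a := fun n =>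
      (prodState_upTo lab D n).comp₂ (upTo_apply le_rfl) fun w z => w = x ∧ z.2 = a
    set s : ℕ → Set (Run S A) := fun n => {ρ | ∃ m, n = m + 1 ∧
      (prodState lab D ρ m = x ∧ (ρ m).2 = a) ∧ prodState lab D ρ (m + 1) = y} with hs
    have hsm : ∀ n, MeasurableSet[Filtration.piLE (X := fun _ : ℕ => S × A) n] (s n) := by
      intro n
      refine UpTo.measurableSet_piLE (p := fun ρ => ∃ m, n = m + 1 ∧
        (prodState lab D ρ m = x ∧ (ρ m).2 = a) ∧ prodState lab D ρ (m + 1) = y) ?_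
      intro ρ ρ' h
      refine propext (exists_congr fun m => and_congr_right ?_)
      rintro rfl
      have e1 := (hu m).mono m.le_succ _ _ h
      have e2 := prodState_upTo lab D (m + 1) _ _ h
      simp only at e1 e2
      rw [e1, e2]
    have hc : ∀ n, (runMeasure M π)[(s (n + 1)).indicator (1 : Run S A → ℝ) |
        Filtration.piLE (X := fun _ : ℕ => S × A) n] =ᵐ[runMeasure M π] fun ρ =>
        (if prodState lab D ρ n = x ∧ (ρ n).2 = a then 1 else 0) *
          (prodTrans M lab D x a y).toReal := by
      intro n
      set g : S × Q → ℝ := fun w => if w = y then 1 else 0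
      set f : Run S A → ℝ := fun ρ => if prodState lab D ρ n = x ∧ (ρ n).2 = a then 1 else 0
      have hf : UpTo n f := fun ρ ρ' h =>
        if_congr (iff_of_eq (hu n ρ ρ' h)) rfl rfl
      have hg : UpTo (n + 1) fun ρ : Run S A => g (prodState lab D ρ (n + 1)) :=
        (prodState_upTo lab D (n + 1)).comp g
      have hi : (s (n + 1)).indicator (1 : Run S A → ℝ) =
          f * fun ρ => g (prodState lab D ρ (n + 1)) := by
        funext ρ
        have : ρ ∈ s (n + 1) ↔ (prodState lab D ρ n = x ∧ (ρ n).2 = a) ∧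
            prodState lab D ρ (n + 1) = y := by
          simp only [hs, Set.mem_ofPred_eq, Nat.add_right_cancel_iff]
          exact ⟨fun ⟨m, hm, h⟩ => by rw [hm]; exact h, fun h => ⟨n, rfl, h⟩⟩
        by_cases h1 : prodState lab D ρ n = x ∧ (ρ n).2 = a <;>
          by_cases h2 : prodState lab D ρ (n + 1) = y <;>
          simp [this, f, g, h1, h2]
      rw [hi]
      have hfg : UpTo (n + 1) (f * fun ρ : Run S A => g (prodState lab D ρ (n + 1))) :=
        (hf.mono n.le_succ).comp₂ hg fun a b => a * b
      refine (condExp_mul_of_stronglyMeasurable_left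
        hf.measurable_piLE.stronglyMeasurable (hfg.integrable _) (hg.integrable _)).trans ?_
      filter_upwards [condExp_prodState_succ lab D M π n g] with ρ hρ
      rw [Pi.mul_apply, hρ]
      by_cases h1 : prodState lab D ρ n = x ∧ (ρ n).2 = a
      · simp [f, g, h1]
      · simp [f, h1]
    filter_upwards [ae_mem_limsup_atTop_iff (runMeasure M π) hsm, ae_all_iff.2 hc]
      with ρ hρ hcρ hfr hne
    have hpos : 0 < (prodTrans M lab D x a y).toReal :=
      ENNReal.toReal_pos hne ((prodTrans M lab D x a).apply_ne_top y)
    have hmem : ρ ∈ limsup s atTop := by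
      rw [hρ]
      simp only [hcρ, ← Finset.sum_mul]
      refine Tendsto.atTop_mul_const hpos ?_
      have := (Set.limsup_eq_tendsto_sum_indicator_atTop (zero_lt_one (α := ℝ))
        fun n => {ρ : Run S A | prodState lab D ρ n = x ∧ (ρ n).2 = a})
      have hm : ρ ∈ limsup (fun n => {ρ : Run S A | prodState lab D ρ n = x ∧ (ρ n).2 = a})
          atTop := mem_limsup_iff_frequently_mem.2 hfr
      rw [this] at hm
      refine hm.congr fun n => Finset.sum_congr rfl fun k _ => ?_
      simp [Set.indicator_apply]
    rw [mem_limsup_iff_frequently_mem] at hmem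
    rw [frequently_atTop] at hmem ⊢
    intro N
    obtain ⟨n, hn, m, rfl, hm⟩ := hmem (N + 1)
    exact ⟨m, by omega, hm⟩
  filter_upwards [ae_next M π, ae_all_iff.2 fun x => ae_all_iff.2 fun a => ae_all_iff.2 (h2 x a)]
    with ρ h1 h2
  refine ⟨fun n => ?_, h2⟩
  rw [← PMF.mem_support_iff, prodTrans, PMF.mem_support_map_iff]
  exact ⟨_, (PMF.mem_support_iff _ _).2 (h1 n).1, (prodState_succ lab D ρ n).symm⟩

end Product

/-! ### Positional strategies on the product -/

section Graph

open Relation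

variable {V A S Q : Type*}

/-- The graph of the transitions of positive probability under a positional strategy. -/
def strategyGraph (T : V → A → PMF V) (σ : V → A) (x y : V) : Prop :=
  T x (σ x) y ≠ 0

/-- Every node that can be reached from `x` can reach `x`. -/
def Recurrent (G : V → V → Prop) (x : V) : Prop :=
  ∀ y, ReflTransGen G x y → ReflTransGen G y x

/-- The nodes reachable from `x` satisfy the Rabin condition, that is, a run visiting exactly these
product states infinitely often is accepted. -/
def AcceptingReach (acc : List (Finset Q × Finset Q)) (G : S × Q → S × Q → Prop) (x : S × Q) :
    Prop :=
  ∃ p ∈ acc, (∃ y, ReflTransGen G x y ∧ y.2 ∈ p.1) ∧ ∀ y, ReflTransGen G x y → y.2 ∉ p.2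

/-- The product states from which a positional strategy wins almost surely: all recurrent classes
of its graph that can be reached are accepting. -/
def Win (T : S × Q → A → PMF (S × Q)) (acc : List (Finset Q × Finset Q)) (σ : S × Q → A) :
    Set (S × Q) :=
  {x | ∀ y, ReflTransGen (strategyGraph T σ) x y → Recurrent (strategyGraph T σ) y →
    AcceptingReach acc (strategyGraph T σ) y}

theorem reflTransGen_iff_of_eq_on_reach {G G' : V → V → Prop} {x : V}
    (h : ∀ z, ReflTransGen G x z → ∀ y, G z y ↔ G' z y) (y : V) :
    ReflTransGen G x y ↔ ReflTransGen G' x y := by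
  constructor
  · intro hxy
    induction hxy with
    | refl => exact .refl
    | tail h1 h2 ih => exact ih.tail ((h _ h1 _).1 h2)
  · intro hxy
    induction hxy with
    | refl => exact .refl
    | tail _ h2 ih => exact ih.tail ((h _ ih _).2 h2)

theorem AcceptingReach.congr {acc : List (Finset Q × Finset Q)} {G G' : S × Q → S × Q → Prop}
    {x x' : S × Q} (h : ∀ y, ReflTransGen G x y ↔ ReflTransGen G' x' y) :
    AcceptingReach acc G x ↔ AcceptingReach acc G' x' := by
  simp only [AcceptingReach, h]

variable {T : S × Q → A → PMF (S × Q)} {acc : List (Finset Q × Finset Q)}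

theorem mem_win_of_reach {σ : S × Q → A} {x y : S × Q} (hx : x ∈ Win T acc σ)
    (hxy : ReflTransGen (strategyGraph T σ) x y) : y ∈ Win T acc σ :=
  fun z hz => hx z (hxy.trans hz)

/-- A strategy that agrees with `σ` on the winning states of `σ` wins from there as well. -/
theorem mem_win_of_eqOn {σ τ : S × Q → A} (h : ∀ x ∈ Win T acc σ, τ x = σ x) {x : S × Q}
    (hx : x ∈ Win T acc σ) :
    x ∈ Win T acc τ ∧ ∀ y, ReflTransGen (strategyGraph T τ) x y → y ∈ Win T acc σ := by
  have hreach : ∀ x ∈ Win T acc σ, ∀ y, ReflTransGen (strategyGraph T σ) x y ↔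
      ReflTransGen (strategyGraph T τ) x y := by
    intro x hx
    refine reflTransGen_iff_of_eq_on_reach fun z hz y => ?_
    simp only [strategyGraph, h z (mem_win_of_reach hx hz)]
  refine ⟨fun y hy hrec => ?_, fun y hy => mem_win_of_reach hx ((hreach x hx y).2 hy)⟩
  have hxy := (hreach x hx y).2 hy
  have hyW := mem_win_of_reach hx hxy
  rw [← AcceptingReach.congr (hreach y hyW)]
  refine hx y hxy fun z hz => ?_
  rw [hreach z (mem_win_of_reach hyW hz)]
  exact hrec z ((hreach y hyW z).1 hz)

open Classical in
/-- Two positional strategies can be merged: follow the first one where it wins and the second one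
elsewhere. -/
theorem win_union_subset (σ₁ σ₂ : S × Q → A) :
    Win T acc σ₁ ∪ Win T acc σ₂ ⊆
      Win T acc fun x => if x ∈ Win T acc σ₁ then σ₁ x else σ₂ x := by
  set τ : S × Q → A := fun x => if x ∈ Win T acc σ₁ then σ₁ x else σ₂ x with hτ
  have h1 : ∀ x ∈ Win T acc σ₁, τ x = σ₁ x := fun x hx => by simp [hτ, hx]
  have h2 : ∀ x ∉ Win T acc σ₁, τ x = σ₂ x := fun x hx => by simp [hτ, hx]
  rintro x (hx | hx)
  · exact (mem_win_of_eqOn h1 hx).1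
  intro y hxy hrec
  by_cases hy : y ∈ Win T acc σ₁
  · exact (mem_win_of_eqOn h1 hy).1 y .refl hrec
  -- Neither a path to `y` nor the recurrent class of `y` meets the winning states of `σ₁`, so
  -- that only `σ₂` matters.
  have hout : ∀ z, ReflTransGen (strategyGraph T τ) z y → z ∉ Win T acc σ₁ :=
    fun z hz hz1 => hy ((mem_win_of_eqOn h1 hz1).2 y hz)
  have hpath : ReflTransGen (strategyGraph T σ₂) x y := by
    induction hxy using ReflTransGen.head_induction_on with
    | refl => exact .refl
    | @head a c hac hcy ih =>
      have ha := h2 a (hout a (hcy.head hac))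
      have hac' : strategyGraph T σ₂ a c := by simpa only [strategyGraph, ha] using hac
      exact (ih (mem_win_of_reach hx (.single hac'))).head hac'
  have heq : ∀ z, ReflTransGen (strategyGraph T τ) y z → ∀ w,
      ReflTransGen (strategyGraph T τ) z w ↔ ReflTransGen (strategyGraph T σ₂) z w := by
    intro z hz
    refine reflTransGen_iff_of_eq_on_reach fun u hu w => ?_
    simp only [strategyGraph, h2 u (hout u (hrec u (hz.trans hu)))]
  rw [AcceptingReach.congr (heq y .refl)]
  refine hx y hpath fun z hz => ?_
  have hz' := (heq y .refl z).2 hz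
  exact (heq z hz' y).1 (hrec z hz')

/-- There is a positional strategy that wins wherever some positional strategy wins. -/
theorem exists_win_maximal [Finite S] [Finite Q] [Finite A] [Nonempty A]
    (T : S × Q → A → PMF (S × Q)) (acc : List (Finset Q × Finset Q)) :
    ∃ σ, ∀ σ', Win T acc σ' ⊆ Win T acc σ := by
  obtain ⟨σ, hσ⟩ := Finite.exists_max fun σ : S × Q → A => (Win T acc σ).ncard
  refine ⟨σ, fun σ' => ?_⟩
  have h := win_union_subset (T := T) (acc := acc) σ σ'
  rw [Set.eq_of_subset_of_ncard_le (Set.subset_union_left.trans h) (hσ _)]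
  exact Set.subset_union_right.trans h

end Graph

/-! ### Fair runs -/

section FairRuns

open Relation

variable {S A AP Q : Type*}

theorem eventually_frequently_eq {β : Type*} [Finite β] (f : ℕ → β) :
    ∀ᶠ n in atTop, ∃ᶠ m in atTop, f m = f n := by
  have h : ∀ b, ∀ᶠ n in atTop, f n = b → ∃ᶠ m in atTop, f m = b := by
    intro b
    by_cases hb : ∃ᶠ m in atTop, f m = b
    · exact .of_forall fun _ _ => hb
    · rw [not_frequently] at hb
      filter_upwards [hb] with n hn h
      exact absurd h hn
  filter_upwards [eventually_all.2 h] with n hn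
  exact hn _ rfl

theorem exists_frequently_eq_of_frequently {β : Type*} [Finite β] {f : ℕ → β} {p : ℕ → Prop}
    (h : ∃ᶠ n in atTop, p n) : ∃ b, ∃ᶠ n in atTop, p n ∧ f n = b := by
  by_contra! hb
  obtain ⟨n, hn, hn'⟩ := (h.and_eventually (eventually_all.2 hb)).exists
  exact hn' (f n) hn rfl

variable {lab : S → A → S → Finset AP} {D : DRA Q AP} {M : MDP S A} {ρ : Run S A}

/-- The product states that a run visits infinitely often. -/
def infSet (lab : S → A → S → Finset AP) (D : DRA Q AP) (ρ : Run S A) : Set (S × Q) :=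
  {x | ∃ᶠ n in atTop, prodState lab D ρ n = x}

theorem accepts_iff_infSet [Finite S] :
    D.Accepts (labels lab ρ) ↔ ∃ p ∈ D.acc, (∃ x ∈ infSet lab D ρ, x.2 ∈ p.1) ∧
      ∀ x ∈ infSet lab D ρ, x.2 ∉ p.2 := by
  have h : ∀ q, q ∈ D.infStates (labels lab ρ) ↔ ∃ s, (s, q) ∈ infSet lab D ρ := by
    intro q
    constructor
    · intro hq
      obtain ⟨s, hs⟩ := exists_frequently_eq_of_frequently (f := fun n => (ρ n).1) hq
      exact ⟨s, hs.mono fun n hn => Prod.ext hn.2 hn.1⟩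
    · rintro ⟨s, hs⟩
      exact hs.mono fun n hn => congrArg Prod.snd hn
  refine exists_congr fun p => and_congr_right fun _ => and_congr ?_ ?_
  · constructor
    · rintro ⟨q, hq, hp⟩
      obtain ⟨s, hs⟩ := (h q).1 hq
      exact ⟨_, hs, hp⟩
    · rintro ⟨⟨s, q⟩, hx, hp⟩
      exact ⟨q, (h q).2 ⟨s, hx⟩, hp⟩
  · rw [Set.eq_empty_iff_forall_notMem]
    constructor
    · rintro hq ⟨s, q⟩ hx hp
      exact hq q ⟨(h q).2 ⟨s, hx⟩, hp⟩
    · rintro hx q ⟨hq, hp⟩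
      obtain ⟨s, hs⟩ := (h q).1 hq
      exact hx _ hs hp

/-- If a run follows the edges of a graph and the set of states visited infinitely often is closed
in the graph, then this set is what can be reached from each of its elements. -/
theorem reflTransGen_iff_mem_infSet {G : S × Q → S × Q → Prop}
    (hG : ∀ n, G (prodState lab D ρ n) (prodState lab D ρ (n + 1)))
    (hcl : ∀ x ∈ infSet lab D ρ, ∀ y, G x y → y ∈ infSet lab D ρ) {x : S × Q}
    (hx : x ∈ infSet lab D ρ) (y : S × Q) : ReflTransGen G x y ↔ y ∈ infSet lab D ρ := by
  constructor
  · intro h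
    induction h with
    | refl => exact hx
    | tail _ h2 ih => exact hcl _ ih _ h2
  · intro hy
    obtain ⟨n, rfl⟩ := hx.exists
    obtain ⟨m, hm, rfl⟩ := frequently_atTop.1 hy n
    obtain ⟨k, rfl⟩ := Nat.exists_eq_add_of_le hm
    clear hm hx hy
    induction k with
    | zero => exact .refl
    | succ k ih => exact ih.tail (hG _)

theorem acceptingReach_iff_accepts [Finite S] {G : S × Q → S × Q → Prop}
    (hG : ∀ n, G (prodState lab D ρ n) (prodState lab D ρ (n + 1)))
    (hcl : ∀ x ∈ infSet lab D ρ, ∀ y, G x y → y ∈ infSet lab D ρ) {x : S × Q}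
    (hx : x ∈ infSet lab D ρ) : AcceptingReach D.acc G x ↔ D.Accepts (labels lab ρ) := by
  rw [accepts_iff_infSet]
  simp only [AcceptingReach, reflTransGen_iff_mem_infSet hG hcl hx]

/-- A fair accepted run visits a state from which some positional strategy wins: from the states
visited infinitely often one can stay among them and move towards an accepting one. -/
theorem IsFair.exists_mem_win [Finite S] [Finite Q] [Finite A] (hf : IsFair lab D M ρ)
    (hacc : D.Accepts (labels lab ρ)) :
    ∃ σ n, prodState lab D ρ n ∈ Win (prodTrans M lab D) D.acc σ := by
  classical
  obtain ⟨p, hp, ⟨z, hz, hzp⟩, hR⟩ := accepts_iff_infSet.1 hacc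
  obtain ⟨N, hN⟩ := eventually_atTop.1
    (eventually_frequently_eq fun n => (prodState lab D ρ n, (ρ n).2))
  -- `d x` is the least time in which the run gets from `x` to `z` after time `N`.
  set P : S × Q → ℕ → Prop := fun x d =>
    ∃ i ≥ N, prodState lab D ρ i = x ∧ prodState lab D ρ (i + d) = z with hP
  set d : S × Q → ℕ := fun x => sInf {d | P x d} with hd
  have hex : ∀ x ∈ infSet lab D ρ, ∃ d, P x d := by
    intro x hx
    obtain ⟨i, hi, hix⟩ := frequently_atTop.1 hx N
    obtain ⟨j, hj, hjz⟩ := frequently_atTop.1 hz i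
    exact ⟨j - i, i, hi, hix, by rwa [Nat.add_sub_cancel' hj]⟩
  have hact : ∀ x, ∃ a, x ∈ infSet lab D ρ →
      (∃ᶠ n in atTop, prodState lab D ρ n = x ∧ (ρ n).2 = a) ∧
      (x = z ∨ ∃ y, prodTrans M lab D x a y ≠ 0 ∧ d y < d x) := by
    intro x
    by_cases hx : x ∈ infSet lab D ρ
    · obtain ⟨i, hi, hix, hiz⟩ : P x (d x) := Nat.sInf_mem (hex x hx)
      refine ⟨(ρ i).2, fun _ => ⟨?_, ?_⟩⟩
      · refine (hN i hi).mono fun n hn => ?_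
        rw [Prod.mk.injEq] at hn
        exact ⟨hn.1.trans hix, hn.2⟩
      · rcases h : d x with _ | k
        · rw [h, add_zero, hix] at hiz
          exact .inl hiz
        · refine .inr ⟨prodState lab D ρ (i + 1), ?_, Nat.lt_succ_of_le (Nat.sInf_le ?_)⟩
          · rw [← hix]
            exact hf.prodTrans_ne_zero i
          · refine ⟨i + 1, by omega, rfl, ?_⟩
            rw [← hiz, h, add_assoc, add_comm 1]
    · exact ⟨(ρ 0).2, fun h => absurd h hx⟩
  choose σ hσ using hact
  have hcl : ∀ x ∈ infSet lab D ρ, ∀ y,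
      ReflTransGen (strategyGraph (prodTrans M lab D) σ) x y → y ∈ infSet lab D ρ := by
    intro x hx y hxy
    induction hxy with
    | refl => exact hx
    | @tail b c _ hbc ih =>
      have h1 := hf.frequently_of_ne_zero b (σ b) c (hσ b ih).1 hbc
      rw [frequently_atTop] at h1
      refine frequently_atTop.2 fun n => ?_
      obtain ⟨m, hm, hm'⟩ := h1 n
      exact ⟨m + 1, by omega, hm'.2⟩
  have hreach : ∀ k, ∀ x ∈ infSet lab D ρ, d x = k →
      ReflTransGen (strategyGraph (prodTrans M lab D) σ) x z := by
    intro k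
    induction k using Nat.strong_induction_on with
    | _ k ih =>
      intro x hx hk
      rcases (hσ x hx).2 with rfl | ⟨y, hy, hyx⟩
      · exact .refl
      · exact (ih (d y) (hk ▸ hyx) y (hcl x hx y (.single hy)) rfl).head hy
  obtain ⟨n, hn⟩ := hz.exists
  refine ⟨σ, n, fun y hy _ => ⟨p, hp, ⟨z, ?_, hzp⟩, fun w hw => ?_⟩⟩
  · exact hreach _ y (hcl _ (hn ▸ hz) y hy) rfl
  · exact hR w (hcl _ (hcl _ (hn ▸ hz) y hy) w hw)

/-- A fair run that follows a positional strategy and visits a state from which it wins is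
accepted. -/
theorem IsFair.accepts_of_mem_win [Finite S] [Finite Q] (hf : IsFair lab D M ρ)
    {σ : S × Q → A} (hσ : ∀ n, (ρ n).2 = σ (prodState lab D ρ n)) {n : ℕ}
    (hn : prodState lab D ρ n ∈ Win (prodTrans M lab D) D.acc σ) :
    D.Accepts (labels lab ρ) := by
  have hG : ∀ n, strategyGraph (prodTrans M lab D) σ (prodState lab D ρ n)
      (prodState lab D ρ (n + 1)) := by
    intro n
    rw [strategyGraph, ← hσ]
    exact hf.prodTrans_ne_zero n
  have hcl : ∀ x ∈ infSet lab D ρ, ∀ y,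
      strategyGraph (prodTrans M lab D) σ x y → y ∈ infSet lab D ρ := by
    intro x hx y hxy
    have h1 := hf.frequently_of_ne_zero x (σ x) y
      (hx.mono fun m hm => ⟨hm, by rw [hσ, hm]⟩) hxy
    rw [frequently_atTop] at h1
    refine frequently_atTop.2 fun n => ?_
    obtain ⟨m, hm, hm'⟩ := h1 n
    exact ⟨m + 1, by omega, hm'.2⟩
  obtain ⟨N, hN⟩ := eventually_atTop.1 (eventually_frequently_eq (prodState lab D ρ))
  have hI : prodState lab D ρ (n + N) ∈ infSet lab D ρ := hN _ (by omega)
  have hpath : ∀ k, ReflTransGen (strategyGraph (prodTrans M lab D) σ) (prodState lab D ρ n)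
      (prodState lab D ρ (n + k)) := by
    intro k
    induction k with
    | zero => exact .refl
    | succ k ih => exact ih.tail (hG _)
  refine (acceptingReach_iff_accepts hG hcl hI).1 (hn _ (hpath N) fun y hy => ?_)
  rw [reflTransGen_iff_mem_infSet hG hcl hI] at hy
  rwa [reflTransGen_iff_mem_infSet hG hcl hy]

end FairRuns

/-! ### The reward machine -/

section Machine

open Relation

variable {S A AP Q : Type*}

/-- The graph formed by a set of labelled edges. -/
def edgeGraph {V A : Type*} (E : Set (V × A × V)) (x y : V) : Prop :=
  ∃ a, (x, a, y) ∈ E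

/-- In no state has more than one action been used. -/
def IsPositional {V A : Type*} (E : Set (V × A × V)) : Prop :=
  ∀ x a y b z, (x, a, y) ∈ E → (x, b, z) ∈ E → a = b

open Classical in
/-- The reward machine that runs the automaton and collects all transitions of the product that
have been seen. It pays `1` if these transitions use at most one action in each product state and
the states to which they lead from the current one satisfy the Rabin condition. -/
noncomputable def edgeMachine (lab : S → A → S → Finset AP) (D : DRA Q AP) :
    RewardMachine (Q × Set ((S × Q) × A × (S × Q))) S A where
  init := (D.init, ∅)
  update u s a s' := (D.step u.1 (lab s a s'),
    insert ((s, u.1), a, prodNext lab D (s, u.1) a s') u.2)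
  reward u s _ _ :=
    if IsPositional u.2 ∧ AcceptingReach D.acc (edgeGraph u.2) (s, u.1) then 1 else 0

variable {lab : S → A → S → Finset AP} {D : DRA Q AP} {M : MDP S A} {ρ : Run S A}

/-- The transition of the product taken at time `i`. -/
def edgeAt (lab : S → A → S → Finset AP) (D : DRA Q AP) (ρ : Run S A) (i : ℕ) :
    (S × Q) × A × (S × Q) :=
  (prodState lab D ρ i, (ρ i).2, prodState lab D ρ (i + 1))

theorem edgeMachine_stateAt (i : ℕ) : (edgeMachine lab D).stateAt ρ i =
    (D.stateAt (labels lab ρ) i, edgeAt lab D ρ '' Set.Iio i) := by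
  induction i with
  | zero => simp [RewardMachine.stateAt, DRA.stateAt, edgeMachine]
  | succ i ih =>
    rw [RewardMachine.stateAt, ih]
    refine Prod.ext rfl ?_
    have : Set.Iio (i + 1) = insert i (Set.Iio i) := by
      ext j
      simp only [Set.mem_Iio, Set.mem_insert_iff]
      omega
    rw [this, Set.image_insert_eq]
    rfl

open Classical in
theorem edgeMachine_rewardAt (i : ℕ) : (edgeMachine lab D).rewardAt ρ i =
    if IsPositional (edgeAt lab D ρ '' Set.Iio i) ∧
      AcceptingReach D.acc (edgeGraph (edgeAt lab D ρ '' Set.Iio i)) (prodState lab D ρ i)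
    then 1 else 0 := by
  rw [RewardMachine.rewardAt, edgeMachine_stateAt]
  rfl

theorem edgeMachine_rewardAt_mem_Icc (i : ℕ) :
    (edgeMachine lab D).rewardAt ρ i ∈ Set.Icc (0 : ℝ) 1 := by
  classical
  rw [edgeMachine_rewardAt]
  split_ifs <;> simp

/-- From some time on, no new transitions are seen. -/
theorem eventually_image_edgeAt_eq [Finite S] [Finite A] [Finite Q] :
    ∀ᶠ i in atTop, edgeAt lab D ρ '' Set.Iio i = Set.range (edgeAt lab D ρ) := by
  have h : ∀ e, ∀ᶠ i in atTop, e ∈ Set.range (edgeAt lab D ρ) →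
      e ∈ edgeAt lab D ρ '' Set.Iio i := by
    intro e
    by_cases he : e ∈ Set.range (edgeAt lab D ρ)
    · obtain ⟨j, rfl⟩ := he
      filter_upwards [eventually_gt_atTop j] with i hi _
      exact ⟨j, hi, rfl⟩
    · exact .of_forall fun _ h => absurd h he
  filter_upwards [eventually_all.2 h] with i hi
  exact (Set.image_subset_range _ _).antisymm fun e he => hi e he

/-- On a fair run along which all choices are positional, the states reachable through the edges
seen so far are eventually those visited infinitely often. -/
theorem IsFair.eventually_acceptingReach_iff [Finite S] [Finite A] [Finite Q]
    (hf : IsFair lab D M ρ) (hpos : IsPositional (Set.range (edgeAt lab D ρ))) :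
    ∀ᶠ i in atTop, AcceptingReach D.acc (edgeGraph (edgeAt lab D ρ '' Set.Iio i))
      (prodState lab D ρ i) ↔ D.Accepts (labels lab ρ) := by
  filter_upwards [eventually_image_edgeAt_eq (lab := lab) (D := D) (ρ := ρ),
    eventually_frequently_eq (prodState lab D ρ)]
    with i hE hI
  rw [hE]
  refine acceptingReach_iff_accepts (fun n => ⟨(ρ n).2, n, rfl⟩) (fun x hx y hxy => ?_) hI
  obtain ⟨a, n, hn⟩ := hxy
  obtain ⟨rfl, rfl, rfl⟩ : prodState lab D ρ n = x ∧ (ρ n).2 = a ∧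
      prodState lab D ρ (n + 1) = y := by
    simpa only [edgeAt, Prod.mk.injEq] using hn
  have h1 := hf.frequently_of_ne_zero _ (ρ n).2 _
    (hx.mono fun m hm => ⟨hm, hpos _ _ _ _ _ ⟨m, rfl⟩ (by rw [hm]; exact ⟨n, rfl⟩)⟩)
    (hf.prodTrans_ne_zero n)
  rw [frequently_atTop] at h1
  refine frequently_atTop.2 fun n => ?_
  obtain ⟨m, hm, hm'⟩ := h1 n
  exact ⟨m + 1, by omega, hm'.2⟩

/-- A fair run that is not accepted eventually earns nothing. -/
theorem IsFair.eventually_rewardAt_eq_zero [Finite S] [Finite A] [Finite Q]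
    (hf : IsFair lab D M ρ) (hacc : ¬ D.Accepts (labels lab ρ)) :
    ∀ᶠ i in atTop, (edgeMachine lab D).rewardAt ρ i = 0 := by
  classical
  by_cases hpos : IsPositional (Set.range (edgeAt lab D ρ))
  · filter_upwards [hf.eventually_acceptingReach_iff hpos] with i hi
    rw [edgeMachine_rewardAt, if_neg fun h => hacc (hi.1 h.2)]
  · filter_upwards [eventually_image_edgeAt_eq (lab := lab) (D := D) (ρ := ρ)] with i hi
    rw [edgeMachine_rewardAt, hi, if_neg fun h => hpos h.1]

/-- A fair accepted run that follows a positional strategy eventually earns `1` in every step. -/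
theorem IsFair.eventually_rewardAt_eq_one [Finite S] [Finite A] [Finite Q]
    (hf : IsFair lab D M ρ) {σ : S × Q → A} (hσ : ∀ n, (ρ n).2 = σ (prodState lab D ρ n))
    (hacc : D.Accepts (labels lab ρ)) :
    ∀ᶠ i in atTop, (edgeMachine lab D).rewardAt ρ i = 1 := by
  classical
  have hpos : IsPositional (Set.range (edgeAt lab D ρ)) := by
    rintro x a y b z ⟨n, hn⟩ ⟨m, hm⟩
    simp only [edgeAt, Prod.mk.injEq] at hn hm
    rw [← hn.2.1, ← hm.2.1, hσ, hσ, hn.1, hm.1]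
  filter_upwards [hf.eventually_acceptingReach_iff hpos,
    eventually_image_edgeAt_eq (lab := lab) (D := D) (ρ := ρ)] with i hi hE
  rw [edgeMachine_rewardAt, if_pos ⟨by rwa [hE], hi.2 hacc⟩]

end Machine

/-! ### Discounted reachability -/

section Discounted

theorem sum_toReal_eq_one {V : Type*} [Fintype V] (p : PMF V) : ∑ y, (p y).toReal = 1 := by
  rw [← ENNReal.toReal_sum fun y _ => p.apply_ne_top y, ← tsum_fintype (L := .unconditional _),
    p.tsum_coe, ENNReal.toReal_one]

variable {V A : Type*} [Fintype V] [Fintype A] [Nonempty A]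

open Classical in
/-- The Bellman operator for reaching `W` with discount factor `β`. -/
noncomputable def bellman (T : V → A → PMF V) (W : Set V) (β : ℝ) (v : V → ℝ) (x : V) : ℝ :=
  if x ∈ W then 1
  else β * Finset.univ.sup' Finset.univ_nonempty fun a => ∑ y, (T x a y).toReal * v y

theorem sup'_le_sup'_add {f g : A → ℝ} {ε : ℝ} (h : ∀ a, f a ≤ g a + ε) :
    Finset.univ.sup' Finset.univ_nonempty f ≤ Finset.univ.sup' Finset.univ_nonempty g + ε :=
  Finset.sup'_le _ _ fun a ha => (h a).trans (add_le_add_left (Finset.le_sup' g ha) ε)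

theorem contractingWith_bellman (T : V → A → PMF V) (W : Set V) {β : NNReal} (hβ : β < 1) :
    ContractingWith β (bellman T W β) := by
  refine ⟨hβ, LipschitzWith.of_dist_le_mul fun u v => ?_⟩
  have key : ∀ (u v : V → ℝ) x, bellman T W β u x ≤ bellman T W β v x + β * dist u v := by
    intro u v x
    unfold bellman
    split_ifs
    · have : 0 ≤ β * dist u v := by positivity
      linarith
    · rw [← mul_add]
      refine mul_le_mul_of_nonneg_left (sup'_le_sup'_add fun a => ?_) β.coe_nonneg
      calc ∑ y, (T x a y).toReal * u y
          ≤ ∑ y, ((T x a y).toReal * v y + (T x a y).toReal * dist u v) := by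
            refine Finset.sum_le_sum fun y _ => ?_
            rw [← mul_add]
            refine mul_le_mul_of_nonneg_left ?_ ENNReal.toReal_nonneg
            have := (le_abs_self _).trans (dist_le_pi_dist u v y)
            linarith
        _ = _ := by rw [Finset.sum_add_distrib, ← Finset.sum_mul, sum_toReal_eq_one, one_mul]
  refine (dist_pi_le_iff (by positivity)).2 fun x => abs_sub_le_iff.2 ⟨?_, ?_⟩
  · linarith [key u v x]
  · rw [dist_comm u v]
    linarith [key v u x]

theorem bellman_mem_Icc (T : V → A → PMF V) (W : Set V) {β : NNReal} (hβ : β < 1)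
    {v : V → ℝ} (hv : v ∈ Set.Icc (0 : V → ℝ) 1) : bellman T W β v ∈ Set.Icc (0 : V → ℝ) 1 := by
  have h0 : ∀ x a, 0 ≤ ∑ y, (T x a y).toReal * v y := fun x a =>
    Finset.sum_nonneg fun y _ => mul_nonneg ENNReal.toReal_nonneg (hv.1 y)
  have h1 : ∀ x a, ∑ y, (T x a y).toReal * v y ≤ 1 := fun x a => by
    rw [← sum_toReal_eq_one (T x a)]
    exact Finset.sum_le_sum fun y _ => mul_le_of_le_one_right ENNReal.toReal_nonneg (hv.2 y)
  constructor <;> intro x <;> simp only [bellman, Pi.zero_apply, Pi.one_apply] <;> split_ifs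
  · exact zero_le_one
  · obtain ⟨a⟩ := ‹Nonempty A›
    exact mul_nonneg β.coe_nonneg ((h0 x a).trans (Finset.le_sup'
      (fun a => ∑ y, (T x a y).toReal * v y) (Finset.mem_univ a)))
  · exact le_rfl
  · refine mul_le_one₀ (by exact_mod_cast hβ.le) ?_ (Finset.sup'_le _ _ fun a _ => h1 x a)
    obtain ⟨a⟩ := ‹Nonempty A›
    exact (h0 x a).trans (Finset.le_sup'
      (fun a => ∑ y, (T x a y).toReal * v y) (Finset.mem_univ a))

/-- The value function of discounted reachability, together with a positional strategy attaining
it. -/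
theorem exists_discounted_value (T : V → A → PMF V) (W : Set V) {β : NNReal} (hβ : β < 1) :
    ∃ (v : V → ℝ) (σ : V → A), (∀ x, v x ∈ Set.Icc 0 1) ∧ (∀ x ∈ W, v x = 1) ∧
      (∀ x ∉ W, ∀ a, β * ∑ y, (T x a y).toReal * v y ≤ v x) ∧
      ∀ x ∉ W, β * ∑ y, (T x (σ x) y).toReal * v y = v x := by
  have hc := contractingWith_bellman T W hβ
  set v := ContractingWith.fixedPoint _ hc
  have hfix : bellman T W β v = v := hc.fixedPoint_isFixedPt
  have hmem : v ∈ Set.Icc (0 : V → ℝ) 1 := by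
    refine isClosed_Icc.mem_of_tendsto (hc.tendsto_iterate_fixedPoint 0) (.of_forall fun n => ?_)
    induction n with
    | zero => simp
    | succ n ih =>
      rw [Function.iterate_succ_apply']
      exact bellman_mem_Icc T W hβ ih
  have hout : ∀ x ∉ W, β * Finset.univ.sup' Finset.univ_nonempty
      (fun a => ∑ y, (T x a y).toReal * v y) = v x := by
    intro x hx
    conv_rhs => rw [← hfix]
    simp [bellman, hx]
  have hσ : ∀ x, ∃ a, Finset.univ.sup' Finset.univ_nonempty
      (fun a => ∑ y, (T x a y).toReal * v y) = ∑ y, (T x a y).toReal * v y := by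
    intro x
    obtain ⟨a, -, ha⟩ := Finset.exists_mem_eq_sup' Finset.univ_nonempty
      fun a => ∑ y, (T x a y).toReal * v y
    exact ⟨a, ha⟩
  choose σ hσ using hσ
  refine ⟨v, σ, fun x => ⟨hmem.1 x, hmem.2 x⟩, fun x hx => ?_, fun x hx a => ?_, fun x hx => ?_⟩
  · rw [← hfix]
    simp [bellman, hx]
  · rw [← hout x hx]
    exact mul_le_mul_of_nonneg_left (Finset.le_sup'
      (fun a => ∑ y, (T x a y).toReal * v y) (Finset.mem_univ a)) β.coe_nonneg
  · rw [← hσ, hout x hx]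

end Discounted

/-! ### The value of a discounted reachability objective along runs -/

section Hitting

variable {S A AP Q : Type*} (lab : S → A → S → Finset AP) (D : DRA Q AP)

/-- The run visits `W` up to time `n`. -/
def VisitedBy (W : Set (S × Q)) (n : ℕ) (ρ : Run S A) : Prop :=
  ∃ k ≤ n, prodState lab D ρ k ∈ W

open Classical in
/-- The process `β ^ n * v (X n)` for the product states `X n`, stopped at the
first visit to `W`. -/
noncomputable def stoppedValue (W : Set (S × Q)) (β : ℝ) (v : S × Q → ℝ) : ℕ → Run S A → ℝ
  | 0, ρ => v (prodState lab D ρ 0)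
  | n + 1, ρ => if VisitedBy lab D W n ρ then stoppedValue W β v n ρ
    else β ^ (n + 1) * v (prodState lab D ρ (n + 1))

variable {lab D} {W : Set (S × Q)} {β : ℝ} {v : S × Q → ℝ}

theorem visitedBy_upTo (n : ℕ) : UpTo n fun ρ : Run S A => VisitedBy lab D W n ρ := by
  intro ρ ρ' h
  refine propext (exists_congr fun k => and_congr_right fun hk => ?_)
  have : prodState lab D ρ k = prodState lab D ρ' k :=
    (prodState_upTo lab D k).mono hk ρ ρ' h
  rw [this]

theorem stoppedValue_upTo (n : ℕ) :
    UpTo n fun ρ : Run S A => stoppedValue lab D W β v n ρ := by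
  classical
  induction n with
  | zero => exact (prodState_upTo lab D 0).comp v
  | succ n ih =>
    intro ρ ρ' h
    have h1 := (visitedBy_upTo (lab := lab) (D := D) (W := W) n).mono n.le_succ ρ ρ' h
    have h2 := ih.mono n.le_succ ρ ρ' h
    have h3 := prodState_upTo lab D (n + 1) ρ ρ' h
    simp only at h1 h2 h3
    simp only [stoppedValue, h1, h2, h3]

theorem stoppedValue_of_not_visitedBy {n : ℕ} {ρ : Run S A} (h : ¬ VisitedBy lab D W n ρ) :
    stoppedValue lab D W β v n ρ = β ^ n * v (prodState lab D ρ n) := by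
  cases n with
  | zero => simp [stoppedValue]
  | succ n => rw [stoppedValue, if_neg fun ⟨k, hk, hk'⟩ => h ⟨k, hk.trans n.le_succ, hk'⟩]

theorem stoppedValue_of_visitedBy (hβ : β ∈ Set.Icc 0 1) (hv : ∀ x ∈ W, v x = 1) {n : ℕ}
    {ρ : Run S A} (h : VisitedBy lab D W n ρ) :
    stoppedValue lab D W β v n ρ ∈ Set.Icc (β ^ n) 1 := by
  induction n with
  | zero =>
    obtain ⟨k, hk, hk'⟩ := h
    obtain rfl : k = 0 := by omega
    simp [stoppedValue, hv _ hk']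
  | succ n ih =>
    by_cases hn : VisitedBy lab D W n ρ
    · rw [stoppedValue, if_pos hn]
      exact ⟨(pow_le_pow_of_le_one hβ.1 hβ.2 n.le_succ).trans (ih hn).1, (ih hn).2⟩
    · obtain ⟨k, hk, hk'⟩ := h
      obtain rfl : k = n + 1 := by
        by_contra hne
        exact hn ⟨k, by omega, hk'⟩
      rw [stoppedValue, if_neg hn, hv _ hk', mul_one]
      exact ⟨le_rfl, pow_le_one₀ hβ.1 hβ.2⟩

variable [Fintype S] [MeasurableSpace S] [DiscreteMeasurableSpace S]
  [Fintype A] [MeasurableSpace A] [DiscreteMeasurableSpace A]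
  {M : MDP S A} {π : Policy S A}

theorem integral_stoppedValue_zero :
    ∫ ρ, stoppedValue lab D W β v 0 ρ ∂(runMeasure M π) = v (M.init, D.init) := by
  have : (fun ρ => stoppedValue lab D W β v 0 ρ) =ᵐ[runMeasure M π]
      fun _ => v (M.init, D.init) := by
    filter_upwards [ae_init M π] with ρ hρ
    simp [stoppedValue, prodState, DRA.stateAt, hρ.1]
  rw [integral_congr_ae this, integral_const]
  simp

theorem visitedBy_measurableSet (n : ℕ) :
    MeasurableSet {ρ : Run S A | VisitedBy lab D W n ρ} :=
  (visitedBy_upTo n).measurableSet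

variable [Fintype Q]

open Classical in
theorem integral_stoppedValue_succ (n : ℕ) :
    ∫ ρ, stoppedValue lab D W β v (n + 1) ρ ∂(runMeasure M π) =
      ∫ ρ, (if VisitedBy lab D W n ρ then stoppedValue lab D W β v n ρ else β ^ n *
        (β * ∑ y, (prodTrans M lab D (prodState lab D ρ n) (ρ n).2 y).toReal * v y))
        ∂(runMeasure M π) := by
  set f : Run S A → ℝ := fun ρ =>
    if VisitedBy lab D W n ρ then stoppedValue lab D W β v n ρ else 0
  set g : Run S A → ℝ := fun ρ => if VisitedBy lab D W n ρ then 0 else β ^ (n + 1)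
  have hf : UpTo n f := (visitedBy_upTo n).comp₂ (stoppedValue_upTo n) fun p r =>
    if p then r else 0
  have hg : UpTo n g := (visitedBy_upTo n).comp fun p => if p then 0 else β ^ (n + 1)
  have h1 : UpTo (n + 1) fun ρ => g ρ * v (prodState lab D ρ (n + 1)) :=
    (hg.mono n.le_succ).comp₂ (prodState_upTo lab D (n + 1)) fun r x => r * v x
  have h2 : UpTo n fun ρ => g ρ *
      ∑ y, (prodTrans M lab D (prodState lab D ρ n) (ρ n).2 y).toReal * v y :=
    hg.comp₂ ((prodState_upTo lab D n).comp₂ (upTo_apply le_rfl) fun x z =>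
      ∑ y, (prodTrans M lab D x z.2 y).toReal * v y) fun r s => r * s
  calc ∫ ρ, stoppedValue lab D W β v (n + 1) ρ ∂(runMeasure M π)
      = ∫ ρ, (f ρ + g ρ * v (prodState lab D ρ (n + 1))) ∂(runMeasure M π) := by
        refine integral_congr_ae (ae_of_all _ fun ρ => ?_)
        by_cases h : VisitedBy lab D W n ρ <;> simp [stoppedValue, f, g, h]
    _ = ∫ ρ, (f ρ + g ρ * ∑ y, (prodTrans M lab D (prodState lab D ρ n) (ρ n).2 y).toReal * v y)
        ∂(runMeasure M π) := by
        rw [integral_add (hf.integrable _) (h1.integrable _),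
          integral_add (hf.integrable _) (h2.integrable _),
          integral_mul_prodState_succ lab D M π hg v]
    _ = _ := by
        refine integral_congr_ae (ae_of_all _ fun ρ => ?_)
        by_cases h : VisitedBy lab D W n ρ
        · simp [f, g, h]
        · simp only [f, g, h, if_false, zero_add]
          ring

/-- No policy reaches `W` with a higher discounted probability than the value. -/
theorem pow_mul_measureReal_visitedBy_le (hβ : β ∈ Set.Icc 0 1) (hv0 : ∀ x, v x ∈ Set.Icc 0 1)
    (hv : ∀ x ∈ W, v x = 1)
    (hsup : ∀ x ∉ W, ∀ a, β * ∑ y, (prodTrans M lab D x a y).toReal * v y ≤ v x) (n : ℕ) :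
    β ^ n * (runMeasure M π).real {ρ | VisitedBy lab D W n ρ} ≤ v (M.init, D.init) := by
  classical
  have hle : ∫ ρ, stoppedValue lab D W β v n ρ ∂(runMeasure M π) ≤ v (M.init, D.init) := by
    induction n with
    | zero => exact integral_stoppedValue_zero.le
    | succ n ih =>
      refine le_trans ?_ ih
      rw [integral_stoppedValue_succ]
      have h2 : UpTo n fun ρ => if VisitedBy lab D W n ρ then stoppedValue lab D W β v n ρ
          else β ^ n *
            (β * ∑ y, (prodTrans M lab D (prodState lab D ρ n) (ρ n).2 y).toReal * v y) := by
        intro ρ ρ' h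
        have e1 := visitedBy_upTo (lab := lab) (D := D) (W := W) n ρ ρ' h
        have e2 := stoppedValue_upTo (lab := lab) (D := D) (W := W) (β := β) (v := v) n ρ ρ' h
        have e3 := prodState_upTo lab D n ρ ρ' h
        simp only at e1 e2 e3
        simp only [e1, e2, e3, h n le_rfl]
      refine integral_mono (h2.integrable _) ((stoppedValue_upTo n).integrable _) fun ρ => ?_
      simp only
      split_ifs with h
      · exact le_rfl
      · rw [stoppedValue_of_not_visitedBy h]
        exact mul_le_mul_of_nonneg_left
          (hsup _ (fun hW => h ⟨n, le_rfl, hW⟩) _) (pow_nonneg hβ.1 n)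
  refine le_trans ?_ hle
  rw [← integral_indicator_one (visitedBy_measurableSet n), ← integral_const_mul]
  have hi : UpTo n fun ρ => β ^ n *
      {ρ : Run S A | VisitedBy lab D W n ρ}.indicator (1 : Run S A → ℝ) ρ :=
    (visitedBy_upTo (W := W) n).comp fun p => β ^ n * if p then 1 else 0
  refine integral_mono (hi.integrable _) ((stoppedValue_upTo n).integrable _) fun ρ => ?_
  by_cases h : VisitedBy lab D W n ρ
  · simpa [h] using (stoppedValue_of_visitedBy hβ hv h).1
  · simpa [h, stoppedValue_of_not_visitedBy h] using
      mul_nonneg (pow_nonneg hβ.1 n) (hv0 _).1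

/-- A strategy that attains the discounted value reaches `W` at least with that probability. -/
theorem le_measureReal_visitedBy_add (hβ : β ∈ Set.Icc 0 1) (hv0 : ∀ x, v x ∈ Set.Icc 0 1)
    (hv : ∀ x ∈ W, v x = 1)
    (heq : ∀ᵐ ρ ∂(runMeasure M π), ∀ n, prodState lab D ρ n ∉ W →
      β * ∑ y, (prodTrans M lab D (prodState lab D ρ n) (ρ n).2 y).toReal * v y =
        v (prodState lab D ρ n)) (n : ℕ) :
    v (M.init, D.init) ≤ (runMeasure M π).real {ρ | VisitedBy lab D W n ρ} + β ^ n := by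
  classical
  have hle : ∫ ρ, stoppedValue lab D W β v n ρ ∂(runMeasure M π) = v (M.init, D.init) := by
    induction n with
    | zero => exact integral_stoppedValue_zero
    | succ n ih =>
      rw [← ih, integral_stoppedValue_succ]
      refine integral_congr_ae ?_
      filter_upwards [heq] with ρ hρ
      split_ifs with h
      · rfl
      · rw [stoppedValue_of_not_visitedBy h, hρ n fun hW => h ⟨n, le_rfl, hW⟩]
  rw [← hle, ← integral_indicator_one (visitedBy_measurableSet n)]
  have hi : UpTo n fun ρ =>
      {ρ : Run S A | VisitedBy lab D W n ρ}.indicator (1 : Run S A → ℝ) ρ :=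
    (visitedBy_upTo (W := W) n).comp fun p => if p then 1 else 0
  have hc : ∫ _ : Run S A, β ^ n ∂(runMeasure M π) = β ^ n := by simp
  rw [← hc, ← integral_add (hi.integrable _) (integrable_const _)]
  refine integral_mono ((stoppedValue_upTo n).integrable _)
    ((hi.integrable _).add (integrable_const _)) fun ρ => ?_
  have hp := pow_nonneg hβ.1 n
  by_cases h : VisitedBy lab D W n ρ
  · have := (stoppedValue_of_visitedBy hβ hv h).2
    simp only [Set.indicator_apply, Set.mem_ofPred_eq, h, if_true, Pi.one_apply]
    linarith
  · simpa [h, stoppedValue_of_not_visitedBy h] using mul_le_of_le_one_right hp (hv0 _).2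

end Hitting

/-! ### Positional policies and their optimality -/

section Optimal

variable {S A AP Q : Type*} (lab : S → A → S → Finset AP) (D : DRA Q AP)

/-- The policy that plays a positional strategy of the product. The automaton state is recomputed
from the history, which is continued arbitrarily to an infinite run. -/
noncomputable def strategyPolicy (σ : S × Q → A) : Policy S A := fun h s =>
  PMF.pure (σ (prodState lab D (fun i => h.getD i (s, σ (s, D.init))) h.length))

variable {lab D} [Fintype S] [MeasurableSpace S] [DiscreteMeasurableSpace S]
  [Fintype A] [MeasurableSpace A] [DiscreteMeasurableSpace A]

theorem ae_strategyPolicy (M : MDP S A) (σ : S × Q → A) :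
    ∀ᵐ ρ ∂(runMeasure M (strategyPolicy lab D σ)), ∀ n, (ρ n).2 = σ (prodState lab D ρ n) := by
  have hpure : ∀ a b : A, PMF.pure a b ≠ 0 → b = a := by
    intro a b h
    rwa [← PMF.mem_support_iff, PMF.support_pure] at h
  filter_upwards [ae_init M (strategyPolicy lab D σ), ae_next M (strategyPolicy lab D σ)]
    with ρ h0 h1 n
  cases n with
  | zero =>
    refine (hpure _ _ h0.2).trans (congrArg σ (prodState_congr lab D (by simp) ?_))
    simp [h0.1]
  | succ n =>
    refine (hpure _ _ (h1 n).2).trans (congrArg σ ?_)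
    have hl : (hist ρ n).length = n + 1 := by simp [hist]
    rw [hl]
    refine prodState_congr lab D (fun i hi => ?_) ?_
    · rw [List.getD_eq_getElem _ _ (hl ▸ hi)]
      simp only [hist, List.getElem_ofFn]
    · rw [List.getD_eq_default _ _ hl.le]

theorem measureReal_visits_eq_limit (M : MDP S A) (π : Policy S A) (W : Set (S × Q)) :
    Tendsto (fun n => (runMeasure M π).real {ρ | VisitedBy lab D W n ρ}) atTop
      (nhds ((runMeasure M π).real {ρ | ∃ n, prodState lab D ρ n ∈ W})) := by
  have hU : {ρ : Run S A | ∃ n, prodState lab D ρ n ∈ W} =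
      ⋃ n, {ρ | VisitedBy lab D W n ρ} := by
    ext ρ
    simp only [Set.mem_ofPred_eq, Set.mem_iUnion]
    exact ⟨fun ⟨n, hn⟩ => ⟨n, n, le_rfl, hn⟩, fun ⟨_, k, _, hk⟩ => ⟨k, hk⟩⟩
  rw [hU]
  refine (ENNReal.tendsto_toReal (measure_ne_top _ _)).comp
    (tendsto_measure_iUnion_atTop fun m n hmn ρ ⟨k, hk, h⟩ => ⟨k, hk.trans hmn, h⟩)

/-- Some positional strategy is optimal for the Rabin objective. -/
theorem exists_positional_optimal [Fintype Q] [Nonempty A] (M : MDP S A) :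
    ∃ σ : S × Q → A, ∀ π, acceptProb M lab D π ≤ acceptProb M lab D (strategyPolicy lab D σ) := by
  classical
  obtain ⟨σW, hW⟩ := exists_win_maximal (prodTrans M lab D) D.acc
  set W := Win (prodTrans M lab D) D.acc σW
  -- Let the discount factors `β k` tend to `1`.
  set β : ℕ → NNReal := fun k => 1 - 1 / ((k : NNReal) + 1) with hβ
  have hβ1 : ∀ k, β k < 1 := fun k => tsub_lt_self one_pos (by positivity)
  have hβc : ∀ k, (β k : ℝ) ∈ Set.Icc (0 : ℝ) 1 := fun k =>
    ⟨(β k).coe_nonneg, by exact_mod_cast (hβ1 k).le⟩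
  have hβlim : Tendsto (fun k => (β k : ℝ)) atTop (nhds 1) := by
    have h : (fun k => (β k : ℝ)) = fun k : ℕ => 1 - 1 / ((k : ℝ) + 1) := by
      funext k
      rw [hβ, NNReal.coe_sub]
      · simp
      · rw [div_le_one₀ (by positivity)]
        exact le_add_self
    rw [h]
    simpa using (tendsto_const_nhds (x := (1 : ℝ))).sub
      (tendsto_one_div_add_atTop_nhds_zero_nat (𝕜 := ℝ))
  choose v σ hv01 hv1 hsup heq using fun k =>
    exists_discounted_value (prodTrans M lab D) W (hβ1 k)
  -- Some strategy attains the discounted value for infinitely many of these factors.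
  obtain ⟨τ₀, hτ₀⟩ := exists_frequently_eq_of_frequently (f := σ) (p := fun _ => True)
    (Eventually.of_forall fun _ => trivial).frequently
  set τ : S × Q → A := fun x => if x ∈ W then σW x else τ₀ x with hτ
  set c := (runMeasure M (strategyPolicy lab D τ)).real {ρ | ∃ n, prodState lab D ρ n ∈ W}
  have hvc : ∀ k, σ k = τ₀ → v k (M.init, D.init) ≤ c := by
    intro k hk
    have hb : ∀ n, v k (M.init, D.init) ≤
        (runMeasure M (strategyPolicy lab D τ)).real {ρ | VisitedBy lab D W n ρ} +
          (β k : ℝ) ^ n := by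
      refine le_measureReal_visitedBy_add (hβc k) (hv01 k) (hv1 k) ?_
      filter_upwards [ae_strategyPolicy M τ] with ρ hρ n hn
      rw [hρ n, hτ]
      simp only [hn, if_false]
      rw [← hk]
      exact heq k _ hn
    have hlim := (measureReal_visits_eq_limit (lab := lab) (D := D) M
      (strategyPolicy lab D τ) W).add
      (tendsto_pow_atTop_nhds_zero_of_lt_one (hβc k).1 (by exact_mod_cast hβ1 k))
    rw [add_zero] at hlim
    exact ge_of_tendsto' hlim hb
  refine ⟨τ, fun π => ?_⟩
  have h1 : acceptProb M lab D π ≤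
      (runMeasure M π).real {ρ | ∃ n, prodState lab D ρ n ∈ W} := by
    refine ENNReal.toReal_mono (measure_ne_top _ _) (measure_mono_ae ?_)
    filter_upwards [ae_isFair lab D M π] with ρ hf hacc
    obtain ⟨σ', n, hn⟩ := hf.exists_mem_win hacc
    exact ⟨n, hW σ' hn⟩
  have h2 : (runMeasure M π).real {ρ | ∃ n, prodState lab D ρ n ∈ W} ≤ c := by
    refine le_of_tendsto' (measureReal_visits_eq_limit M π W) fun n => ?_
    have hlim : Tendsto (fun k => (β k : ℝ) ^ n *
        (runMeasure M π).real {ρ | VisitedBy lab D W n ρ}) atTop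
        (nhds ((runMeasure M π).real {ρ | VisitedBy lab D W n ρ})) := by
      simpa using (hβlim.pow n).mul_const ((runMeasure M π).real {ρ | VisitedBy lab D W n ρ})
    refine le_of_tendsto_of_frequently hlim (hτ₀.mono fun k hk => ?_)
    exact (pow_mul_measureReal_visitedBy_le (hβc k) (hv01 k) (hv1 k) (hsup k) n).trans
      (hvc k hk.2)
  have h3 : c ≤ acceptProb M lab D (strategyPolicy lab D τ) := by
    refine ENNReal.toReal_mono (measure_ne_top _ _) (measure_mono_ae ?_)
    filter_upwards [ae_isFair lab D M (strategyPolicy lab D τ), ae_strategyPolicy M τ]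
      with ρ hf hρ hvis
    obtain ⟨n, hn⟩ := hvis
    exact hf.accepts_of_mem_win hρ
      (mem_win_of_eqOn (τ := τ) (fun x hx => by simp only [hτ]; exact if_pos hx) hn).1
  exact h1.trans (h2.trans h3)

end Optimal

/-! ### Limit averages and acceptance probabilities -/

section Average

variable {S A AP Q U : Type*}

theorem RewardMachine.stateAt_upTo (R : RewardMachine U S A) (i : ℕ) :
    UpTo i fun ρ : Run S A => R.stateAt ρ i := by
  induction i with
  | zero => exact fun _ _ _ => rfl
  | succ i ih =>
    intro ρ ρ' h
    have e : R.stateAt ρ i = R.stateAt ρ' i := ih.mono i.le_succ ρ ρ' h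
    simp only [RewardMachine.stateAt, e, h i i.le_succ, h (i + 1) le_rfl]

theorem RewardMachine.rewardAt_upTo (R : RewardMachine U S A) (i : ℕ) :
    UpTo (i + 1) fun ρ : Run S A => R.rewardAt ρ i := by
  intro ρ ρ' h
  have e : R.stateAt ρ i = R.stateAt ρ' i := (R.stateAt_upTo i).mono i.le_succ ρ ρ' h
  simp only [RewardMachine.rewardAt, e, h i i.le_succ, h (i + 1) le_rfl]

/-- The average of the first `t` rewards. -/
noncomputable def averageReward (R : RewardMachine U S A) (t : ℕ) (ρ : Run S A) : ℝ :=
  (1 / (t : ℝ)) * ∑ i ∈ Finset.range t, R.rewardAt ρ i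

theorem averageReward_upTo (R : RewardMachine U S A) (t : ℕ) :
    UpTo t fun ρ => averageReward R t ρ := by
  intro ρ ρ' h
  have : ∀ i ∈ Finset.range t, R.rewardAt ρ i = R.rewardAt ρ' i := fun i hi =>
    (R.rewardAt_upTo i).mono (Finset.mem_range.1 hi) ρ ρ' h
  simp only [averageReward, Finset.sum_congr rfl this]

theorem tendsto_averageReward {R : RewardMachine U S A} {ρ : Run S A} {c : ℝ}
    (h : ∀ᶠ i in atTop, R.rewardAt ρ i = c) :
    Tendsto (fun t => averageReward R t ρ) atTop (nhds c) := by
  have := (tendsto_const_nhds.congr' (h.mono fun i hi => hi.symm)).cesaro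
  simpa only [averageReward, one_div] using this

theorem averageReward_mem_Icc {R : RewardMachine U S A} {ρ : Run S A}
    (h : ∀ i, R.rewardAt ρ i ∈ Set.Icc (0 : ℝ) 1) (t : ℕ) :
    averageReward R t ρ ∈ Set.Icc (0 : ℝ) 1 := by
  have h0 : 0 ≤ ∑ i ∈ Finset.range t, R.rewardAt ρ i := Finset.sum_nonneg fun i _ => (h i).1
  have h1 : ∑ i ∈ Finset.range t, R.rewardAt ρ i ≤ t := by
    simpa using Finset.sum_le_sum fun i (_ : i ∈ Finset.range t) => (h i).2
  refine ⟨by unfold averageReward; positivity, ?_⟩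
  rw [averageReward, one_div, inv_mul_eq_div]
  exact div_le_one_of_le₀ h1 t.cast_nonneg

variable [Fintype S] [MeasurableSpace S] [DiscreteMeasurableSpace S]
  [Fintype A] [MeasurableSpace A] [DiscreteMeasurableSpace A]
  {lab : S → A → S → Finset AP} {D : DRA Q AP} {M : MDP S A} {π : Policy S A}

theorem measurableSet_accepts [Finite Q] (lab : S → A → S → Finset AP) (D : DRA Q AP) :
    MeasurableSet {ρ : Run S A | D.Accepts (labels lab ρ)} := by
  have hI : Measurable fun (ρ : Run S A) (x : S × Q) => x ∈ infSet lab D ρ := by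
    refine measurable_pi_iff.2 fun x => measurableSet_setOfPred.1 ?_
    have : {ρ : Run S A | x ∈ infSet lab D ρ} =
        limsup (fun n => {ρ : Run S A | prodState lab D ρ n = x}) atTop := by
      ext ρ
      rw [mem_limsup_iff_frequently_mem]
      rfl
    rw [this]
    exact MeasurableSet.measurableSet_limsup fun n =>
      ((prodState_upTo lab D n).comp fun y => y = x).measurableSet
  have : {ρ : Run S A | D.Accepts (labels lab ρ)} =
      (fun (ρ : Run S A) (x : S × Q) => x ∈ infSet lab D ρ) ⁻¹'
        {I | ∃ p ∈ D.acc, (∃ x, I x ∧ x.2 ∈ p.1) ∧ ∀ x, I x → x.2 ∉ p.2} := by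
    ext ρ
    exact accepts_iff_infSet
  rw [this]
  exact hI (Set.toFinite _).measurableSet

/-- If the average rewards converge to `c` almost surely on an event, the expected average rewards
earned on this event converge to `c` times its probability. -/
theorem tendsto_integral_indicator_averageReward {R : RewardMachine U S A}
    (hR : ∀ ρ i, R.rewardAt ρ i ∈ Set.Icc (0 : ℝ) 1) {B : Set (Run S A)} (hB : MeasurableSet B)
    {c : ℝ} (h : ∀ᵐ ρ ∂(runMeasure M π), ρ ∈ B → ∀ᶠ i in atTop, R.rewardAt ρ i = c) :
    Tendsto (fun t => ∫ ρ, B.indicator (averageReward R t) ρ ∂(runMeasure M π)) atTop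
      (nhds (c * (runMeasure M π).real B)) := by
  have hlim : ∫ ρ, B.indicator (fun _ => c) ρ ∂(runMeasure M π) =
      c * (runMeasure M π).real B := by
    rw [integral_indicator_const _ hB, smul_eq_mul, mul_comm]
  rw [← hlim]
  refine tendsto_integral_of_dominated_convergence (fun _ => 1)
    (fun t => ((averageReward_upTo R t).measurable.indicator hB).aestronglyMeasurable)
    (integrable_const _) (fun t => ae_of_all _ fun ρ => ?_) ?_
  · have := averageReward_mem_Icc (hR ρ) t
    by_cases hρ : ρ ∈ B
    · simpa [hρ, abs_of_nonneg this.1] using this.2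
    · simp [hρ]
  · filter_upwards [h] with ρ hρ
    by_cases hB : ρ ∈ B
    · simpa [hB] using tendsto_averageReward (hρ hB)
    · simp [hB]

theorem limitAverage_eq (R : RewardMachine U S A) :
    limitAverage M R π =
      liminf (fun t => ∫ ρ, averageReward R t ρ ∂(runMeasure M π)) atTop :=
  rfl

theorem integral_averageReward_mem_Icc {R : RewardMachine U S A}
    (hR : ∀ ρ i, R.rewardAt ρ i ∈ Set.Icc (0 : ℝ) 1) (t : ℕ) :
    ∫ ρ, averageReward R t ρ ∂(runMeasure M π) ∈ Set.Icc (0 : ℝ) 1 := by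
  refine ⟨integral_nonneg fun ρ => (averageReward_mem_Icc (hR ρ) t).1, ?_⟩
  have := integral_mono ((averageReward_upTo R t).integrable (runMeasure M π))
    (integrable_const (1 : ℝ)) fun ρ => (averageReward_mem_Icc (hR ρ) t).2
  simpa using this

/-- No policy earns more than its probability of acceptance. -/
theorem limitAverage_edgeMachine_le [Finite Q] :
    limitAverage M (edgeMachine lab D) π ≤ acceptProb M lab D π := by
  have hR : ∀ (ρ : Run S A) i, (edgeMachine lab D).rewardAt ρ i ∈ Set.Icc (0 : ℝ) 1 :=
    fun ρ i => edgeMachine_rewardAt_mem_Icc i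
  set B : Set (Run S A) := {ρ | D.Accepts (labels lab ρ)}
  have hBm : MeasurableSet B := measurableSet_accepts lab D
  have := Fintype.ofFinite Q
  have hlim := tendsto_integral_indicator_averageReward (M := M) (π := π) hR hBm.compl
      (c := 0) <| by
    filter_upwards [ae_isFair lab D M π] with ρ hf hacc
    exact hf.eventually_rewardAt_eq_zero hacc
  rw [zero_mul] at hlim
  have hlim' := hlim.const_add ((runMeasure M π).real B)
  rw [add_zero] at hlim'
  rw [limitAverage_eq, acceptProb, ← hlim'.liminf_eq]
  refine liminf_le_liminf (.of_forall fun t => ?_)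
    (isBoundedUnder_of ⟨0, fun t => (integral_averageReward_mem_Icc hR t).1⟩)
    hlim'.isCoboundedUnder_ge
  have hi : Integrable (averageReward (edgeMachine lab D) t) (runMeasure M π) :=
    (averageReward_upTo _ t).integrable _
  have h1 : Integrable (B.indicator (1 : Run S A → ℝ)) (runMeasure M π) :=
    (integrable_const (1 : ℝ)).indicator hBm
  rw [← integral_indicator_one hBm, ← integral_add h1 (hi.indicator hBm.compl)]
  refine integral_mono hi (h1.add (hi.indicator hBm.compl)) fun ρ => ?_
  by_cases hρ : ρ ∈ B
  · simpa [hρ] using (averageReward_mem_Icc (hR ρ) t).2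
  · simp [hρ]

/-- Positional policies earn their probability of acceptance. -/
theorem acceptProb_le_limitAverage_edgeMachine [Finite Q] (σ : S × Q → A) :
    acceptProb M lab D (strategyPolicy lab D σ) ≤
      limitAverage M (edgeMachine lab D) (strategyPolicy lab D σ) := by
  have hR : ∀ (ρ : Run S A) i, (edgeMachine lab D).rewardAt ρ i ∈ Set.Icc (0 : ℝ) 1 :=
    fun ρ i => edgeMachine_rewardAt_mem_Icc i
  have hBm : MeasurableSet {ρ : Run S A | D.Accepts (labels lab ρ)} :=
    measurableSet_accepts lab D
  have := Fintype.ofFinite Q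
  have hlim := tendsto_integral_indicator_averageReward (M := M)
      (π := strategyPolicy lab D σ) hR hBm (c := 1) <| by
    filter_upwards [ae_isFair lab D M (strategyPolicy lab D σ), ae_strategyPolicy M σ]
      with ρ hf hσ hacc
    exact hf.eventually_rewardAt_eq_one hσ hacc
  rw [one_mul] at hlim
  rw [limitAverage_eq, acceptProb, ← hlim.liminf_eq]
  have hbdd : IsBoundedUnder (· ≤ ·) atTop fun t => ∫ ρ, averageReward (edgeMachine lab D) t ρ
      ∂(runMeasure M (strategyPolicy lab D σ)) :=
    isBoundedUnder_of ⟨1, fun t => (integral_averageReward_mem_Icc hR t).2⟩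
  refine liminf_le_liminf (.of_forall fun t => ?_) hlim.isBoundedUnder_ge hbdd.isCoboundedUnder_ge
  have hi := (averageReward_upTo (edgeMachine lab D) t).integrable
    (runMeasure M (strategyPolicy lab D σ))
  refine integral_mono (hi.indicator hBm) hi fun ρ => ?_
  exact Set.indicator_le_self' (fun _ _ => (averageReward_mem_Icc (hR ρ) t).1) ρ

/-- The machine preserves optimality: its optimal value is at least that of an optimal positional
strategy for acceptance, and every policy is accepted at least with the probability that it
earns. -/
theorem optimalityPreserving_edgeMachine [Finite Q] (lab : S → A → S → Finset AP)
    (D : DRA Q AP) : OptimalityPreserving lab D (edgeMachine lab D) := by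
  intro M π hπ π'
  have := Fintype.ofFinite Q
  have : Nonempty A := ⟨(π [] M.init).support_nonempty.some⟩
  obtain ⟨σ, hσ⟩ := exists_positional_optimal (lab := lab) (D := D) M
  calc acceptProb M lab D π' ≤ acceptProb M lab D (strategyPolicy lab D σ) := hσ π'
    _ ≤ limitAverage M (edgeMachine lab D) (strategyPolicy lab D σ) :=
      acceptProb_le_limitAverage_edgeMachine σ
    _ ≤ limitAverage M (edgeMachine lab D) π := hπ _
    _ ≤ acceptProb M lab D π := limitAverage_edgeMachine_le

/-- A reward machine that simulates, through a map of the states, one that preserves optimality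
preserves optimality as well: both earn the same rewards on each run. -/
theorem OptimalityPreserving.of_simulation {U' : Type*} {R : RewardMachine U S A}
    (hR : OptimalityPreserving lab D R) (R' : RewardMachine U' S A) (f : U' → U)
    (hinit : f R'.init = R.init)
    (hupdate : ∀ u s a s', f (R'.update u s a s') = R.update (f u) s a s')
    (hreward : ∀ u s a s', R'.reward u s a s' = R.reward (f u) s a s') :
    OptimalityPreserving lab D R' := by
  have hs : ∀ ρ i, f (R'.stateAt ρ i) = R.stateAt ρ i := by
    intro ρ i
    induction i with
    | zero => exact hinit
    | succ i ih =>
      rw [RewardMachine.stateAt, RewardMachine.stateAt, hupdate, ih]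
  have hr : ∀ ρ i, R'.rewardAt ρ i = R.rewardAt ρ i := by
    intro ρ i
    rw [RewardMachine.rewardAt, RewardMachine.rewardAt, hreward, hs]
  have hl : ∀ M π, limitAverage M R' π = limitAverage M R π := by
    intro M π
    simp only [limitAverage, hr]
  intro M π hπ
  refine hR M π fun π' => ?_
  rw [← hl, ← hl]
  exact hπ π'

/-- For finite sets there is a reward machine with finitely many states that preserves
optimality. -/
theorem exists_optimalityPreserving [Finite Q] (lab : S → A → S → Finset AP) (D : DRA Q AP) :
    ∃ (n : ℕ) (R : RewardMachine (Fin n) S A), OptimalityPreserving lab D R := by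
  let e := Finite.equivFin (Q × Set ((S × Q) × A × (S × Q)))
  let E := edgeMachine lab D
  refine ⟨_, ⟨e E.init, fun u s a s' => e (E.update (e.symm u) s a s'),
    fun u s a s' => E.reward (e.symm u) s a s'⟩, ?_⟩
  refine (optimalityPreserving_edgeMachine lab D).of_simulation _ e.symm ?_ ?_ ?_
  · exact e.symm_apply_apply _
  · exact fun u s a s' => e.symm_apply_apply _
  · exact fun _ _ _ _ => rfl

end Average

/-! ### Binary codes of finite sets -/

section Codes

theorem testBit_add_two_pow {E i : ℕ} (h : E.testBit i = false) (j : ℕ) :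
    (E + 2 ^ i).testBit j = (E.testBit j || decide (i = j)) := by
  -- As bit `i` is clear, adding `2 ^ i` amounts to the bitwise disjunction.
  have hl : E % 2 ^ i < 2 ^ i := Nat.mod_lt _ (by positivity)
  have hlow : E / 2 ^ i % 2 = 0 := by
    rw [Nat.testBit_eq_decide_div_mod_eq, decide_eq_false_iff_not] at h
    omega
  obtain ⟨k, hk⟩ : ∃ k, E / 2 ^ i = 2 * k := ⟨E / 2 ^ i / 2, by omega⟩
  have hE : E = 2 ^ i * (2 * k) + E % 2 ^ i := by rw [← hk, Nat.div_add_mod]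
  have hpow : 2 ^ i < 2 ^ (i + 1) := Nat.pow_lt_pow_right one_lt_two i.lt_succ_self
  have h1 : E = 2 ^ i * (2 * k) ||| E % 2 ^ i := by
    rw [← Nat.two_pow_add_eq_or_of_lt hl, ← hE]
  have h2 : E + 2 ^ i = 2 ^ i * (2 * k + 1) ||| E % 2 ^ i := by
    rw [← Nat.two_pow_add_eq_or_of_lt hl]
    linarith
  have h3 : 2 ^ i * (2 * k + 1) = 2 ^ i * (2 * k) ||| 2 ^ i := by
    have := Nat.two_pow_add_eq_or_of_lt hpow k
    rw [show 2 ^ i * (2 * k) = 2 ^ (i + 1) * k by ring, ← this]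
    ring
  rw [h2, h3]
  conv_rhs => rw [h1]
  simp only [Nat.testBit_or, Nat.testBit_two_pow]
  cases (2 ^ i * (2 * k)).testBit j <;> cases (E % 2 ^ i).testBit j <;> simp

/-- The code that results from adding the element `i` to the set with code `E`. -/
def insertBit (E i : ℕ) : ℕ := if E.testBit i then E else E + 2 ^ i

theorem testBit_insertBit (E i j : ℕ) :
    (insertBit E i).testBit j = (E.testBit j || decide (i = j)) := by
  unfold insertBit
  split_ifs with h
  · by_cases hij : i = j
    · subst hij
      simp [h]
    · simp [hij]
  · exact testBit_add_two_pow (by simpa using h) j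

theorem insertBit_lt {E i n : ℕ} (hE : E < 2 ^ n) (hi : i < n) : insertBit E i < 2 ^ n := by
  refine Nat.lt_pow_two_of_testBit _ fun j hj => ?_
  rw [testBit_insertBit, Nat.testBit_lt_two_pow (hE.trans_le (Nat.pow_le_pow_right two_pos hj))]
  simpa using by omega

theorem testBit_setCode {n : ℕ} (s : Finset (Fin n)) (i : Fin n) :
    (setCode s).testBit i = decide (i ∈ s) := by
  classical
  induction s using Finset.induction_on generalizing i with
  | empty => simp [setCode]
  | insert a s ha ih =>
    have : setCode (insert a s) = setCode s + 2 ^ (a : ℕ) := by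
      rw [setCode, Finset.sum_insert ha, add_comm, setCode]
    rw [this, testBit_add_two_pow (by simp [ih, ha]), ih]
    simp only [Finset.mem_insert, Bool.decide_or, Fin.ext_iff, eq_comm, Bool.or_comm]

theorem setCode_lt {n : ℕ} (s : Finset (Fin n)) : setCode s < 2 ^ n := by
  have h : setCode s ≤ ∑ i : Fin n, 2 ^ (i : ℕ) :=
    Finset.sum_le_sum_of_subset (Finset.subset_univ s)
  rw [Fin.sum_univ_eq_sum_range fun i => 2 ^ i, Nat.geomSum_eq le_rfl] at h
  have : 0 < 2 ^ n := by positivity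
  omega

theorem setOfCode_setCode {n : ℕ} (s : Finset (Fin n)) : setOfCode n (setCode s) = s := by
  ext i
  simp [setOfCode, testBit_setCode]

end Codes

/-! ### The reward machine as a function of the code of a specification -/

namespace SpecCode

/-- The number of states of the MDP. -/
def nS (c : SpecCode) : ℕ := c.1.1

/-- The number of actions. -/
def nA (c : SpecCode) : ℕ := c.1.2.1

/-- The number of states of the automaton. -/
def nQ (c : SpecCode) : ℕ := c.1.2.2.2

/-- The number of product states. -/
def nV (c : SpecCode) : ℕ := c.nS * c.nQ

/-- The number of possible labelled edges between product states. -/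
def nE (c : SpecCode) : ℕ := c.nV * c.nA * c.nV

/-- The code of the label of a transition. -/
def label (c : SpecCode) (s a s' : ℕ) : ℕ := ((c.2.1.getD s []).getD a []).getD s' 0

/-- The transition function of the automaton. -/
def step (c : SpecCode) (q l : ℕ) : ℕ := (c.2.2.2.1.getD q []).getD l 0

/-- The number of a product state. -/
def pair (c : SpecCode) (s q : ℕ) : ℕ := q + c.nQ * s

/-- The number of a labelled edge. -/
def edge (c : SpecCode) (v a w : ℕ) : ℕ := w + c.nV * (a + c.nA * v)

/-- The automaton state reached from `q` by a transition. -/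
def succ (c : SpecCode) (q s a s' : ℕ) : ℕ := c.step q (c.label s a s')

/-- The update function: the state `(q, E)` of the reward machine has the number `q + nQ * E`. -/
def update (c : SpecCode) (u s a s' : ℕ) : ℕ :=
  c.succ (u % c.nQ) s a s' + c.nQ * insertBit (u / c.nQ)
    (c.edge (c.pair s (u % c.nQ)) a (c.pair s' (c.succ (u % c.nQ) s a s')))

/-- The edges in `E` use at most one action in each state. -/
def Positional (c : SpecCode) (E : ℕ) : Prop :=
  ∀ v < c.nV, ∀ a < c.nA, ∀ w < c.nV, ∀ b < c.nA, ∀ z < c.nV,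
    E.testBit (c.edge v a w) → E.testBit (c.edge v b z) → a = b

/-- The set `X` of product states is closed under the edges in `E`. -/
def Closed (c : SpecCode) (E X : ℕ) : Prop :=
  ∀ v < c.nV, ∀ a < c.nA, ∀ w < c.nV, E.testBit (c.edge v a w) → X.testBit v → X.testBit w

/-- The set of states reachable from `v` avoids `R`, by a closed set that witnesses it. -/
def Avoids (c : SpecCode) (E v R : ℕ) : Prop :=
  ∃ X < 2 ^ c.nV, c.Closed E X ∧ X.testBit v ∧ ∀ w < c.nV, X.testBit w → ¬ R.testBit (w % c.nQ)

/-- The set of states reachable from `v` meets `B`, as every closed set containing `v` does. -/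
def Meets (c : SpecCode) (E v B : ℕ) : Prop :=
  ∀ X < 2 ^ c.nV, c.Closed E X → X.testBit v → ∃ w < c.nV, X.testBit w ∧ B.testBit (w % c.nQ)

/-- The condition for the reward `1`. -/
def Pays (c : SpecCode) (u s : ℕ) : Prop :=
  c.Positional (u / c.nQ) ∧ ∃ p ∈ c.2.2.2.2,
    c.Meets (u / c.nQ) (c.pair s (u % c.nQ)) p.1 ∧ c.Avoids (u / c.nQ) (c.pair s (u % c.nQ)) p.2

open Classical in
/-- The code of the reward machine. -/
noncomputable def machine (c : SpecCode) : MachineCode :=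
  (c.nQ * 2 ^ c.nE, c.2.2.1,
    (List.range (c.nQ * 2 ^ c.nE)).map fun u => (List.range c.nS).map fun s =>
      (List.range c.nA).map fun a => (List.range c.nS).map fun s' =>
        (c.update u s a s', if c.Pays u s then 1 else 0, 1))

end SpecCode

/-! ### Computability -/

section Computability

variable {α : Type*} [Primcodable α]

theorem primrecPred_forall_lt {f : α → ℕ} {p : α → ℕ → Prop} (hf : Primrec f)
    (hp : PrimrecPred fun y : α × ℕ => p y.1 y.2) : PrimrecPred fun x => ∀ n < f x, p x n := by
  have hR : PrimrecRel fun (n : ℕ) (x : α) => p x n := hp.comp (Primrec.snd.pair .fst)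
  exact ((hR.forall_mem_list.comp (Primrec.list_range.comp hf) .id)).of_eq fun x => by simp

theorem primrecPred_exists_lt {f : α → ℕ} {p : α → ℕ → Prop} (hf : Primrec f)
    (hp : PrimrecPred fun y : α × ℕ => p y.1 y.2) : PrimrecPred fun x => ∃ n < f x, p x n := by
  have hR : PrimrecRel fun (n : ℕ) (x : α) => p x n := hp.comp (Primrec.snd.pair .fst)
  exact ((hR.exists_mem_list.comp (Primrec.list_range.comp hf) .id)).of_eq fun x => by simp

theorem primrecPred_imp {p q : α → Prop} (hp : PrimrecPred p) (hq : PrimrecPred q) :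
    PrimrecPred fun x => p x → q x :=
  (hp.not.or hq).of_eq fun _ => imp_iff_not_or.symm

theorem primrec_two_pow {f : α → ℕ} (hf : Primrec f) : Primrec fun x => 2 ^ f x :=
  (Primrec₂.unpaired'.1 Nat.Primrec.pow).comp (.const 2) hf

theorem primrecPred_testBit {f g : α → ℕ} (hf : Primrec f) (hg : Primrec g) :
    PrimrecPred fun x => (f x).testBit (g x) = true := by
  refine (Primrec.eq.comp (Primrec.nat_mod.comp
    (Primrec.nat_div.comp hf (primrec_two_pow hg)) (.const 2)) (.const 1)).of_eq fun x => ?_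
  rw [Nat.testBit_eq_decide_div_mod_eq, decide_eq_true_iff]

theorem primrec_insertBit {f g : α → ℕ} (hf : Primrec f) (hg : Primrec g) :
    Primrec fun x => insertBit (f x) (g x) :=
  Primrec.ite (primrecPred_testBit hf hg) hf (Primrec.nat_add.comp hf (primrec_two_pow hg))

namespace SpecCode

theorem primrec_nS : Primrec nS := Primrec.fst.comp .fst

theorem primrec_nA : Primrec nA := Primrec.fst.comp (Primrec.snd.comp .fst)

theorem primrec_nQ : Primrec nQ :=
  Primrec.snd.comp (Primrec.snd.comp (Primrec.snd.comp .fst))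

theorem primrec_nV : Primrec nV := Primrec.nat_mul.comp primrec_nS primrec_nQ

theorem primrec_nE : Primrec nE :=
  Primrec.nat_mul.comp (Primrec.nat_mul.comp primrec_nV primrec_nA) primrec_nV

variable {c : α → SpecCode}

theorem primrec_pair {f g : α → ℕ} (hc : Primrec c) (hf : Primrec f) (hg : Primrec g) :
    Primrec fun x => (c x).pair (f x) (g x) :=
  Primrec.nat_add.comp hg (Primrec.nat_mul.comp (primrec_nQ.comp hc) hf)

theorem primrec_edge {f g h : α → ℕ} (hc : Primrec c) (hf : Primrec f) (hg : Primrec g)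
    (hh : Primrec h) : Primrec fun x => (c x).edge (f x) (g x) (h x) :=
  Primrec.nat_add.comp hh (Primrec.nat_mul.comp (primrec_nV.comp hc)
    (Primrec.nat_add.comp hg (Primrec.nat_mul.comp (primrec_nA.comp hc) hf)))

theorem primrec_label {f g h : α → ℕ} (hc : Primrec c) (hf : Primrec f) (hg : Primrec g)
    (hh : Primrec h) : Primrec fun x => (c x).label (f x) (g x) (h x) :=
  (Primrec.list_getD 0).comp ((Primrec.list_getD []).comp ((Primrec.list_getD []).comp
    (Primrec.fst.comp (Primrec.snd.comp hc)) hf) hg) hh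

theorem primrec_step {f g : α → ℕ} (hc : Primrec c) (hf : Primrec f) (hg : Primrec g) :
    Primrec fun x => (c x).step (f x) (g x) :=
  (Primrec.list_getD 0).comp ((Primrec.list_getD []).comp
    (Primrec.fst.comp (Primrec.snd.comp (Primrec.snd.comp (Primrec.snd.comp hc)))) hf) hg

theorem primrec_succ {f g h k : α → ℕ} (hc : Primrec c) (hf : Primrec f) (hg : Primrec g)
    (hh : Primrec h) (hk : Primrec k) : Primrec fun x => (c x).succ (f x) (g x) (h x) (k x) :=
  primrec_step hc hf (primrec_label hc hg hh hk)

theorem primrec_update {f g h k : α → ℕ} (hc : Primrec c) (hf : Primrec f) (hg : Primrec g)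
    (hh : Primrec h) (hk : Primrec k) : Primrec fun x => (c x).update (f x) (g x) (h x) (k x) := by
  have hQ := primrec_nQ.comp hc
  have hq := Primrec.nat_mod.comp hf hQ
  have hs := primrec_succ hc hq hg hh hk
  exact Primrec.nat_add.comp hs (Primrec.nat_mul.comp hQ (primrec_insertBit
    (Primrec.nat_div.comp hf hQ)
    (primrec_edge hc (primrec_pair hc hg hq) hh (primrec_pair hc hk hs))))

theorem primrecPred_positional {f : α → ℕ} (hc : Primrec c) (hf : Primrec f) :
    PrimrecPred fun x => (c x).Positional (f x) := by
  have f5 : Primrec fun y : ((((α × ℕ) × ℕ) × ℕ) × ℕ) × ℕ => y.1.1.1.1.1 :=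
    Primrec.fst.comp (Primrec.fst.comp (Primrec.fst.comp (Primrec.fst.comp .fst)))
  have v5 : Primrec fun y : ((((α × ℕ) × ℕ) × ℕ) × ℕ) × ℕ => y.1.1.1.1.2 :=
    Primrec.snd.comp (Primrec.fst.comp (Primrec.fst.comp (Primrec.fst.comp .fst)))
  have a5 : Primrec fun y : ((((α × ℕ) × ℕ) × ℕ) × ℕ) × ℕ => y.1.1.1.2 :=
    Primrec.snd.comp (Primrec.fst.comp (Primrec.fst.comp .fst))
  have w5 : Primrec fun y : ((((α × ℕ) × ℕ) × ℕ) × ℕ) × ℕ => y.1.1.2 :=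
    Primrec.snd.comp (Primrec.fst.comp .fst)
  have b5 : Primrec fun y : ((((α × ℕ) × ℕ) × ℕ) × ℕ) × ℕ => y.1.2 := Primrec.snd.comp .fst
  have hc1 := hc.comp (Primrec.fst (β := ℕ))
  have hc2 := hc1.comp (Primrec.fst (β := ℕ))
  have hc3 := hc2.comp (Primrec.fst (β := ℕ))
  have hc4 := hc3.comp (Primrec.fst (β := ℕ))
  have hc5 := hc.comp f5
  exact primrecPred_forall_lt (primrec_nV.comp hc) <|
    primrecPred_forall_lt (primrec_nA.comp hc1) <|
    primrecPred_forall_lt (primrec_nV.comp hc2) <|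
    primrecPred_forall_lt (primrec_nA.comp hc3) <|
    primrecPred_forall_lt (primrec_nV.comp hc4) <|
    primrecPred_imp (primrecPred_testBit (hf.comp f5) (primrec_edge hc5 v5 a5 w5)) <|
    primrecPred_imp (primrecPred_testBit (hf.comp f5) (primrec_edge hc5 v5 b5 .snd)) <|
    Primrec.eq.comp a5 b5

theorem primrecPred_closed {f g : α → ℕ} (hc : Primrec c) (hf : Primrec f) (hg : Primrec g) :
    PrimrecPred fun x => (c x).Closed (f x) (g x) := by
  have f3 : Primrec fun y : ((α × ℕ) × ℕ) × ℕ => y.1.1.1 :=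
    Primrec.fst.comp (Primrec.fst.comp .fst)
  have v3 : Primrec fun y : ((α × ℕ) × ℕ) × ℕ => y.1.1.2 :=
    Primrec.snd.comp (Primrec.fst.comp .fst)
  have a3 : Primrec fun y : ((α × ℕ) × ℕ) × ℕ => y.1.2 := Primrec.snd.comp .fst
  have hc1 := hc.comp (Primrec.fst (β := ℕ))
  have hc2 := hc1.comp (Primrec.fst (β := ℕ))
  exact primrecPred_forall_lt (primrec_nV.comp hc) <|
    primrecPred_forall_lt (primrec_nA.comp hc1) <|
    primrecPred_forall_lt (primrec_nV.comp hc2) <|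
    primrecPred_imp (primrecPred_testBit (hf.comp f3) (primrec_edge (hc.comp f3) v3 a3 .snd)) <|
    primrecPred_imp (primrecPred_testBit (hg.comp f3) v3) <|
    primrecPred_testBit (hg.comp f3) .snd

theorem primrecPred_testBit_mod {f g : α → ℕ} (hc : Primrec c) (hf : Primrec f)
    (hg : Primrec g) : PrimrecPred fun x => (f x).testBit (g x % (c x).nQ) = true :=
  primrecPred_testBit hf (Primrec.nat_mod.comp hg (primrec_nQ.comp hc))

theorem primrecPred_avoids {f g h : α → ℕ} (hc : Primrec c) (hf : Primrec f) (hg : Primrec g)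
    (hh : Primrec h) : PrimrecPred fun x => (c x).Avoids (f x) (g x) (h x) := by
  have f1 : Primrec fun y : α × ℕ => y.1 := .fst
  have f2 : Primrec fun y : (α × ℕ) × ℕ => y.1.1 := Primrec.fst.comp .fst
  have x2 : Primrec fun y : (α × ℕ) × ℕ => y.1.2 := Primrec.snd.comp .fst
  exact primrecPred_exists_lt (primrec_two_pow (primrec_nV.comp hc)) <|
    (primrecPred_closed (hc.comp f1) (hf.comp f1) .snd).and <|
    (primrecPred_testBit .snd (hg.comp f1)).and <|
    primrecPred_forall_lt (primrec_nV.comp (hc.comp f1)) <|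
    primrecPred_imp (primrecPred_testBit x2 .snd) <|
    (primrecPred_testBit_mod (hc.comp f2) (hh.comp f2) .snd).not

theorem primrecPred_meets {f g h : α → ℕ} (hc : Primrec c) (hf : Primrec f) (hg : Primrec g)
    (hh : Primrec h) : PrimrecPred fun x => (c x).Meets (f x) (g x) (h x) := by
  have f1 : Primrec fun y : α × ℕ => y.1 := .fst
  have f2 : Primrec fun y : (α × ℕ) × ℕ => y.1.1 := Primrec.fst.comp .fst
  have x2 : Primrec fun y : (α × ℕ) × ℕ => y.1.2 := Primrec.snd.comp .fst
  exact primrecPred_forall_lt (primrec_two_pow (primrec_nV.comp hc)) <|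
    primrecPred_imp (primrecPred_closed (hc.comp f1) (hf.comp f1) .snd) <|
    primrecPred_imp (primrecPred_testBit .snd (hg.comp f1)) <|
    primrecPred_exists_lt (primrec_nV.comp (hc.comp f1)) <|
    (primrecPred_testBit x2 .snd).and <|
    primrecPred_testBit_mod (hc.comp f2) (hh.comp f2) .snd

theorem primrecPred_pays {f g : α → ℕ} (hc : Primrec c) (hf : Primrec f) (hg : Primrec g) :
    PrimrecPred fun x => (c x).Pays (f x) (g x) := by
  have hE := Primrec.nat_div.comp hf (primrec_nQ.comp hc)
  have hv := primrec_pair hc hg (Primrec.nat_mod.comp hf (primrec_nQ.comp hc))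
  have f1 : Primrec fun y : (ℕ × ℕ) × α => y.2 := .snd
  have hR : PrimrecRel fun (p : ℕ × ℕ) (x : α) =>
      (c x).Meets (f x / (c x).nQ) ((c x).pair (g x) (f x % (c x).nQ)) p.1 ∧
        (c x).Avoids (f x / (c x).nQ) ((c x).pair (g x) (f x % (c x).nQ)) p.2 :=
    (primrecPred_meets (hc.comp f1) (hE.comp f1) (hv.comp f1) (Primrec.fst.comp .fst)).and
      (primrecPred_avoids (hc.comp f1) (hE.comp f1) (hv.comp f1) (Primrec.snd.comp .fst))
  exact (primrecPred_positional hc hE).and (hR.exists_mem_list.comp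
    (Primrec.snd.comp (Primrec.snd.comp (Primrec.snd.comp (Primrec.snd.comp hc)))) .id)

theorem primrec_machine : Primrec machine := by
  classical
  have hN : Primrec fun c : SpecCode => c.nQ * 2 ^ c.nE :=
    Primrec.nat_mul.comp primrec_nQ (primrec_two_pow primrec_nE)
  have c4 : Primrec fun y : (((SpecCode × ℕ) × ℕ) × ℕ) × ℕ => y.1.1.1.1 :=
    Primrec.fst.comp (Primrec.fst.comp (Primrec.fst.comp .fst))
  have u4 : Primrec fun y : (((SpecCode × ℕ) × ℕ) × ℕ) × ℕ => y.1.1.1.2 :=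
    Primrec.snd.comp (Primrec.fst.comp (Primrec.fst.comp .fst))
  have s4 : Primrec fun y : (((SpecCode × ℕ) × ℕ) × ℕ) × ℕ => y.1.1.2 :=
    Primrec.snd.comp (Primrec.fst.comp .fst)
  have a4 : Primrec fun y : (((SpecCode × ℕ) × ℕ) × ℕ) × ℕ => y.1.2 := Primrec.snd.comp .fst
  have hentry : Primrec fun y : (((SpecCode × ℕ) × ℕ) × ℕ) × ℕ =>
      (y.1.1.1.1.update y.1.1.1.2 y.1.1.2 y.1.2 y.2,
        (if y.1.1.1.1.Pays y.1.1.1.2 y.1.1.2 then (1 : ℤ) else 0), 1) :=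
    (primrec_update c4 u4 s4 a4 .snd).pair
      ((Primrec.ite (primrecPred_pays c4 u4 s4) (.const 1) (.const 0)).pair (.const 1))
  have c1 : Primrec fun y : SpecCode × ℕ => y.1 := .fst
  have c2 := c1.comp (Primrec.fst (β := ℕ))
  have c3 := c2.comp (Primrec.fst (β := ℕ))
  exact hN.pair ((Primrec.fst.comp (Primrec.snd.comp .snd)).pair <|
    Primrec.list_map (Primrec.list_range.comp hN) <|
    Primrec.list_map (Primrec.list_range.comp (primrec_nS.comp c1)) <|
    Primrec.list_map (Primrec.list_range.comp (primrec_nA.comp c2)) <|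
    Primrec.list_map (Primrec.list_range.comp (primrec_nS.comp c3)) hentry)

end SpecCode
end Computability

/-! ### Correctness of the coded reward machine -/

section Reach

open Relation

variable {V : Type*} {G : V → V → Prop} {x : V} {p : V → Prop}

theorem exists_closed_avoiding_iff :
    (∃ B : Set V, (∀ y z, G y z → y ∈ B → z ∈ B) ∧ x ∈ B ∧ ∀ y ∈ B, ¬ p y) ↔
      ∀ y, ReflTransGen G x y → ¬ p y := by
  constructor
  · rintro ⟨B, hB, hx, hp⟩ y hy
    refine hp y ?_
    induction hy with
    | refl => exact hx
    | tail _ h ih => exact hB _ _ h ih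
  · exact fun h => ⟨{y | ReflTransGen G x y}, fun y z hyz hy => ReflTransGen.tail hy hyz, .refl, h⟩

theorem forall_closed_meets_iff :
    (∀ B : Set V, (∀ y z, G y z → y ∈ B → z ∈ B) → x ∈ B → ∃ y ∈ B, p y) ↔
      ∃ y, ReflTransGen G x y ∧ p y := by
  rw [← not_iff_not]
  push Not
  exact exists_closed_avoiding_iff

end Reach

section Simulation

variable (X : Spec)

/-- The number of a product state. -/
def Spec.index (x : Fin X.nS × Fin X.nQ) : ℕ := X.code.pair x.1 x.2

/-- The number of a labelled edge. -/
def Spec.edgeIndex (e : (Fin X.nS × Fin X.nQ) × Fin X.nA × (Fin X.nS × Fin X.nQ)) : ℕ :=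
  X.code.edge (X.index e.1) e.2.1 (X.index e.2.2)

variable {X}

theorem add_mul_lt {a b m n : ℕ} (ha : a < m) (hb : b < n) : a + m * b < n * m := by
  calc a + m * b < m + m * b := by omega
    _ = (b + 1) * m := by ring
    _ ≤ n * m := Nat.mul_le_mul_right m hb

theorem add_mul_inj {a b a' b' m : ℕ} (ha : a < m) (ha' : a' < m) :
    a + m * b = a' + m * b' ↔ a = a' ∧ b = b' := by
  constructor
  · intro h
    have h1 := congrArg (· % m) h
    have h2 := congrArg (· / m) h
    have hm : 0 < m := by omega
    simp only [Nat.add_mul_mod_self_left, Nat.mod_eq_of_lt ha, Nat.mod_eq_of_lt ha'] at h1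
    simp only [Nat.add_mul_div_left _ _ hm, Nat.div_eq_of_lt ha, Nat.div_eq_of_lt ha',
      zero_add] at h2
    exact ⟨h1, h2⟩
  · rintro ⟨rfl, rfl⟩
    rfl

theorem Spec.index_lt (x : Fin X.nS × Fin X.nQ) : X.index x < X.code.nV :=
  add_mul_lt x.2.2 x.1.2

theorem Spec.index_mod (x : Fin X.nS × Fin X.nQ) : X.index x % X.nQ = x.2 := by
  rw [Spec.index, SpecCode.pair, show X.code.nQ = X.nQ from rfl, Nat.add_mul_mod_self_left,
    Nat.mod_eq_of_lt x.2.2]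

theorem Spec.index_inj {x y : Fin X.nS × Fin X.nQ} : X.index x = X.index y ↔ x = y := by
  rw [Spec.index, Spec.index, SpecCode.pair, SpecCode.pair, show X.code.nQ = X.nQ from rfl,
    add_mul_inj x.2.2 y.2.2, Prod.ext_iff, Fin.ext_iff, Fin.ext_iff, and_comm]

theorem Spec.exists_index {v : ℕ} (hv : v < X.code.nV) : ∃ x, X.index x = v := by
  have hv' : v < X.nS * X.nQ := hv
  have hQ : 0 < X.nQ := Nat.pos_of_ne_zero fun h => by simp [h] at hv'
  exact ⟨(⟨v / X.nQ, (Nat.div_lt_iff_lt_mul hQ).2 hv'⟩, ⟨v % X.nQ, Nat.mod_lt _ hQ⟩),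
    Nat.mod_add_div _ _⟩

theorem Spec.edgeIndex_lt (e : (Fin X.nS × Fin X.nQ) × Fin X.nA × (Fin X.nS × Fin X.nQ)) :
    X.edgeIndex e < X.code.nE := by
  have h := add_mul_lt (X.index_lt e.2.2) (add_mul_lt e.2.1.2 (X.index_lt e.1))
  exact h

theorem Spec.edgeIndex_inj
    {e e' : (Fin X.nS × Fin X.nQ) × Fin X.nA × (Fin X.nS × Fin X.nQ)} :
    X.edgeIndex e = X.edgeIndex e' ↔ e = e' := by
  rw [Spec.edgeIndex, Spec.edgeIndex, SpecCode.edge, SpecCode.edge,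
    add_mul_inj (X.index_lt _) (X.index_lt _),
    show X.code.nA = X.nA from rfl, add_mul_inj e.2.1.2 e'.2.1.2, Spec.index_inj, Spec.index_inj,
    ← Fin.ext_iff]
  exact ⟨fun h => Prod.ext h.2.2 (Prod.ext h.2.1 h.1), by rintro rfl; exact ⟨rfl, rfl, rfl⟩⟩

theorem Spec.forall_lt_nV_iff {p : ℕ → Prop} :
    (∀ v < X.code.nV, p v) ↔ ∀ x, p (X.index x) := by
  refine ⟨fun h x => h _ (X.index_lt x), fun h v hv => ?_⟩
  obtain ⟨x, rfl⟩ := Spec.exists_index hv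
  exact h x

theorem Spec.exists_lt_nV_iff {p : ℕ → Prop} :
    (∃ v < X.code.nV, p v) ↔ ∃ x, p (X.index x) := by
  refine ⟨fun ⟨v, hv, h⟩ => ?_, fun ⟨x, h⟩ => ⟨_, X.index_lt x, h⟩⟩
  obtain ⟨x, rfl⟩ := Spec.exists_index hv
  exact ⟨x, h⟩

/-- Every set of product states has a code. -/
theorem Spec.exists_setCode_iff {p : Set (Fin X.nS × Fin X.nQ) → Prop} :
    (∃ B < 2 ^ X.code.nV, p {x | B.testBit (X.index x)}) ↔ ∃ B, p B := by
  classical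
  refine ⟨fun ⟨B, _, h⟩ => ⟨_, h⟩, fun ⟨B, h⟩ => ?_⟩
  refine ⟨Nat.ofBits fun i : Fin X.code.nV => decide (∃ x ∈ B, X.index x = i),
    Nat.ofBits_lt_two_pow _, ?_⟩
  convert h
  ext x
  rw [Set.mem_ofPred_eq, Nat.testBit_ofBits_lt _ _ (X.index_lt x), decide_eq_true_iff]
  simp only [Spec.index_inj]
  simp

theorem Spec.forall_setCode_iff {p : Set (Fin X.nS × Fin X.nQ) → Prop} :
    (∀ B < 2 ^ X.code.nV, p {x | B.testBit (X.index x)}) ↔ ∀ B, p B := by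
  have := Spec.exists_setCode_iff (X := X) (p := fun B => ¬ p B)
  rw [← not_iff_not]
  push Not
  exact this

/-- The set of edges with a given code. -/
def Spec.edgeSet (X : Spec) (E : ℕ) :
    Set ((Fin X.nS × Fin X.nQ) × Fin X.nA × (Fin X.nS × Fin X.nQ)) :=
  {e | E.testBit (X.edgeIndex e)}

theorem Spec.edgeSet_insertBit (E : ℕ)
    (e : (Fin X.nS × Fin X.nQ) × Fin X.nA × (Fin X.nS × Fin X.nQ)) :
    X.edgeSet (insertBit E (X.edgeIndex e)) = insert e (X.edgeSet E) := by
  ext e'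
  simp only [Spec.edgeSet, Set.mem_ofPred_eq, Set.mem_insert_iff, testBit_insertBit,
    Bool.or_eq_true, decide_eq_true_eq, Spec.edgeIndex_inj]
  rw [or_comm, eq_comm]

theorem Spec.positional_iff (E : ℕ) : X.code.Positional E ↔ IsPositional (X.edgeSet E) := by
  simp only [SpecCode.Positional, Spec.forall_lt_nV_iff]
  constructor
  · exact fun h x a y b z h1 h2 => Fin.ext (h x a a.2 y b b.2 z h1 h2)
  · exact fun h x a ha y b hb z h1 h2 =>
      congrArg Fin.val (h x ⟨a, ha⟩ y ⟨b, hb⟩ z h1 h2)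

theorem Spec.closed_iff (E B : ℕ) : X.code.Closed E B ↔ ∀ x y, edgeGraph (X.edgeSet E) x y →
    x ∈ {x | B.testBit (X.index x)} → y ∈ {x | B.testBit (X.index x)} := by
  simp only [SpecCode.Closed, Spec.forall_lt_nV_iff]
  constructor
  · rintro h x y ⟨a, ha⟩
    exact h x a a.2 y ha
  · exact fun h x a ha y hxy => h x y ⟨⟨a, ha⟩, hxy⟩

theorem Spec.avoids_iff (E : ℕ) (x : Fin X.nS × Fin X.nQ) (R : Finset (Fin X.nQ)) :
    X.code.Avoids E (X.index x) (setCode R) ↔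
      ∀ y, Relation.ReflTransGen (edgeGraph (X.edgeSet E)) x y → y.2 ∉ R := by
  rw [← exists_closed_avoiding_iff, ← Spec.exists_setCode_iff]
  simp only [SpecCode.Avoids, Spec.closed_iff, Spec.forall_lt_nV_iff,
    show X.code.nQ = X.nQ from rfl, Spec.index_mod, testBit_setCode, decide_eq_true_iff,
    Set.mem_ofPred_eq]

theorem Spec.meets_iff (E : ℕ) (x : Fin X.nS × Fin X.nQ) (B : Finset (Fin X.nQ)) :
    X.code.Meets E (X.index x) (setCode B) ↔
      ∃ y, Relation.ReflTransGen (edgeGraph (X.edgeSet E)) x y ∧ y.2 ∈ B := by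
  rw [← forall_closed_meets_iff, ← Spec.forall_setCode_iff]
  simp only [SpecCode.Meets, Spec.closed_iff, Spec.exists_lt_nV_iff,
    show X.code.nQ = X.nQ from rfl, Spec.index_mod, testBit_setCode, decide_eq_true_iff,
    Set.mem_ofPred_eq]

/-- The number of states of the reward machine. -/
def Spec.machineSize (X : Spec) : ℕ := X.nQ * 2 ^ X.code.nE

theorem Spec.nQ_pos (X : Spec) : 0 < X.nQ := X.dra.init.pos

/-- The state of the machine `edgeMachine` with a given number. -/
def Spec.decodeState (X : Spec) (u : ℕ) :
    Fin X.nQ × Set ((Fin X.nS × Fin X.nQ) × Fin X.nA × (Fin X.nS × Fin X.nQ)) :=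
  (⟨u % X.nQ, Nat.mod_lt _ X.nQ_pos⟩, X.edgeSet (u / X.nQ))

theorem Spec.pays_iff (u : ℕ) (s : Fin X.nS) : X.code.Pays u s ↔
    IsPositional (X.decodeState u).2 ∧
      AcceptingReach X.dra.acc (edgeGraph (X.decodeState u).2) (s, (X.decodeState u).1) := by
  have hpair : X.code.pair s (u % X.code.nQ) = X.index (s, (X.decodeState u).1) := rfl
  rw [SpecCode.Pays, hpair, Spec.positional_iff, AcceptingReach]
  refine and_congr_right fun _ => ?_
  have hacc : X.code.2.2.2.2 = X.dra.acc.map fun p => (setCode p.1, setCode p.2) := rfl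
  rw [hacc]
  simp only [List.mem_map, exists_exists_and_eq_and, Spec.meets_iff, Spec.avoids_iff]
  rfl

theorem getD_ofFn {β : Type*} {n : ℕ} (f : Fin n → β) (i : Fin n) (d : β) :
    (List.ofFn f).getD i d = f i := by
  rw [List.getD_eq_getElem _ _ (by simp)]
  simp

theorem Spec.succ_eq (q : Fin X.nQ) (s : Fin X.nS) (a : Fin X.nA) (s' : Fin X.nS) :
    X.code.succ q s a s' = X.dra.step q (X.label s a s') := by
  have hl : X.code.label s a s' = setCode (X.label s a s') := by
    simp only [SpecCode.label, Spec.code, getD_ofFn]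
  rw [SpecCode.succ, hl]
  simp only [SpecCode.step, Spec.code, getD_ofFn]
  rw [getD_ofFn _ ⟨setCode (X.label s a s'), setCode_lt _⟩, setOfCode_setCode]

theorem Spec.update_eq (u : ℕ) (s : Fin X.nS) (a : Fin X.nA) (s' : Fin X.nS) :
    X.code.update u s a s' = (X.dra.step (X.decodeState u).1 (X.label s a s') : ℕ) +
      X.nQ * insertBit (u / X.nQ) (X.edgeIndex ((s, (X.decodeState u).1), a,
        prodNext X.label X.dra (s, (X.decodeState u).1) a s')) := by
  have h := Spec.succ_eq (X.decodeState u).1 s a s'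
  rw [SpecCode.update, show u % X.code.nQ = (X.decodeState u).1 from rfl, h]
  rfl

theorem Spec.update_lt {u : ℕ} (hu : u < X.machineSize) (s : Fin X.nS) (a : Fin X.nA)
    (s' : Fin X.nS) : X.code.update u s a s' < X.machineSize := by
  rw [Spec.update_eq, Spec.machineSize, mul_comm X.nQ (2 ^ _)]
  exact add_mul_lt (Fin.is_lt _)
    (insertBit_lt (Nat.div_lt_of_lt_mul hu) (X.edgeIndex_lt _))

theorem Spec.init_lt (X : Spec) : (X.dra.init : ℕ) < X.machineSize :=
  X.dra.init.2.trans_le (Nat.le_mul_of_pos_right _ (by positivity))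

open Classical in
/-- The reward machine with the code `X.code.machine`. -/
noncomputable def Spec.rewardMachine (X : Spec) : FiniteRewardMachine X.nS X.nA where
  nU := X.machineSize
  init := ⟨X.dra.init, X.init_lt⟩
  update u s a s' := ⟨X.code.update u s a s', X.update_lt u.2 s a s'⟩
  reward u s _ _ := if X.code.Pays u s then 1 else 0

theorem Spec.decodeState_update (u : ℕ) (s : Fin X.nS) (a : Fin X.nA) (s' : Fin X.nS) :
    X.decodeState (X.code.update u s a s') =
      (edgeMachine X.label X.dra).update (X.decodeState u) s a s' := by
  rw [Spec.update_eq]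
  refine Prod.ext (Fin.ext ?_) ?_
  · change (_ + _) % _ = _
    rw [Nat.add_mul_mod_self_left, Nat.mod_eq_of_lt (Fin.is_lt _)]
    rfl
  · change X.edgeSet ((_ + _) / _) = _
    rw [Nat.add_mul_div_left _ _ X.nQ_pos, Nat.div_eq_of_lt (Fin.is_lt _), zero_add,
      Spec.edgeSet_insertBit]
    rfl

theorem Spec.optimalityPreserving_rewardMachine (X : Spec) :
    OptimalityPreserving X.label X.dra X.rewardMachine.toRewardMachine := by
  classical
  refine (optimalityPreserving_edgeMachine X.label X.dra).of_simulation _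
    (fun u => X.decodeState u) ?_ ?_ ?_
  · refine Prod.ext (Fin.ext (Nat.mod_eq_of_lt X.dra.init.2)) ?_
    change X.edgeSet (X.dra.init / X.nQ) = ∅
    rw [Nat.div_eq_of_lt X.dra.init.2]
    simp [Spec.edgeSet]
  · exact fun u s a s' => X.decodeState_update u s a s'
  · intro u s a s'
    simp only [FiniteRewardMachine.toRewardMachine, Spec.rewardMachine, edgeMachine]
    by_cases h : X.code.Pays u s
    · rw [if_pos h, if_pos ((X.pays_iff u s).1 h), Rat.cast_one]
    · rw [if_neg h, if_neg fun h' => h ((X.pays_iff u s).2 h'), Rat.cast_zero]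

theorem map_range_eq_ofFn {β : Type*} {n : ℕ} {f : ℕ → β} {g : Fin n → β}
    (h : ∀ i : Fin n, f i = g i) : (List.range n).map f = List.ofFn g := by
  rw [List.ofFn_eq_map, ← List.map_coe_finRange_eq_range, List.map_map]
  exact List.map_congr_left fun i _ => h i

theorem Spec.machine_code (X : Spec) : X.code.machine = X.rewardMachine.code := by
  refine Prod.ext rfl (Prod.ext rfl ?_)
  refine map_range_eq_ofFn fun u => map_range_eq_ofFn fun s => map_range_eq_ofFn fun a =>
    map_range_eq_ofFn fun s' => ?_
  refine Prod.ext rfl (Prod.ext ?_ ?_) <;>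
  · simp only [Spec.rewardMachine]
    split_ifs <;> rfl

end Simulation
end OmegaReg

theorem mainTheorem1 :
    (∃ τ : (X : OmegaReg.Spec) → OmegaReg.FiniteRewardMachine X.nS X.nA,
      OmegaReg.ComputableTranslation τ ∧
      ∀ X : OmegaReg.Spec,
        OmegaReg.OptimalityPreserving X.label X.dra (τ X).toRewardMachine) ∧
    (∀ {S A AP Q : Type*}
      [Fintype S] [MeasurableSpace S] [DiscreteMeasurableSpace S]
      [Fintype A] [MeasurableSpace A] [DiscreteMeasurableSpace A]
      [Fintype AP] [Fintype Q]
      (lab : S → A → S → Finset AP) (D : OmegaReg.DRA Q AP),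
      ∃ (n : ℕ) (R : OmegaReg.RewardMachine (Fin n) S A),
        OmegaReg.OptimalityPreserving lab D R) :=
  ⟨⟨OmegaReg.Spec.rewardMachine,
    ⟨OmegaReg.SpecCode.machine, OmegaReg.SpecCode.primrec_machine.to_comp,
      OmegaReg.Spec.machine_code⟩,
    OmegaReg.Spec.optimalityPreserving_rewardMachine⟩,
  fun lab D => OmegaReg.exists_optimalityPreserving lab D⟩
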